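/- **Setting.** Let $d,n\ge 1$, $X^i\in\mathbb R^{m_i\times d}$ for $i=1,\dots,n$, $m=\sum_i m_i$, $y\in\mathbb R^m$, $\gamma>0$, $\sigma>0$, let $I\subseteq\{1,\dots,d\}\times\{1,\dots,n\}$ with $t=|I|$, and let $\tilde w,\tilde u\in\mathbb R^t$, where the coordinates of $\mathbb R^t$ are indexed by $I$. Let $X=\mathrm{Diag}(X^1,\dots,X^n)$, whose column $(i,j)$ multiplies the entry $W_{ij}$ of a matrix $W\in\mathbb R^{d\times n}$, and let $X_I\in\mathbb R^{m\times t}$ consist of its columns indexed by $I$. For $q\in\mathbb R^t$ let $Q\in\mathbb R^{d\times n}$ be its extension by zero. For each $i$ let $\lambda_i$ be the smallest index $k$ with $|Q_{ik}|=\max_j|Q_{ij}|$, and put $T_{i\lambda_i}=\operatorname{sign}(Q_{i\lambda_i})$ and $T_{ij}=0$ for $j\neq\lambda_i$. Let $\bar{\mathcal C}(q)$ be the polyhedron of all $z\in\mathbb R^t$ whose extension by zero $Z$ satisfies, for all $(i,j)$, $$-\operatorname{sign}(Q_{ij})Z_{ij}\le 0,\qquad \operatorname{sign}(Q_{ij})Z_{ij}-T_{i\lambda_i}Z_{i\lambda_i}\le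 0,\qquad \sum_{i=1}^d T_{i\lambda_i}Z_{i\lambda_i}\le\gamma ,$$ written $\bar{\mathcal C}(q)=\{z: \bar Bz\le c\}$ with $\bar B=\bar B(q)\in\mathbb R^{(2nd+1)\times t}$. Let $$\varphi(w)=\tfrac12\|y-X_Iw\|^2-\tfrac1{2\sigma}\|\tilde u\|^2+\sigma\min_{z\in\bar{\mathcal C}(q)}\tfrac12\|z-q\|^2\Big|_{q=w+\tilde u/\sigma}+\tfrac1{2\sigma}\|w-\tilde w\|^2,\qquad w\in\mathbb R^t .$$ (The minimum does not change if $\bar{\mathcal C}(q)$ is replaced by $\{z:\sum_i\max_j|Z_{ij}|\le\gamma\}$.) The generalized HS-Jacobian $\bar{\mathcal N}(q)$ is the set of the matrices $I_t-\bar B_K^\top(\bar B_K\bar B_K^\top)^{-1}\bar B_K$, where $\bar B=\bar B(q)$ and $K$ is a set of row indices such that $\bar B_K$ has full row rank and $\operatorname{supp}(\mu)\subseteq K\subseteq\{r:(\bar Bp)_r=c_r\}$, with $p$ the projection of $q$ onto $\bar{\mathcal C}(q)$ and $\mu$ some multiplier, i.e. $\mu\ge0$, $p-q+\bar B^\top\mu=0$,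 $\mu^\top(\bar Bp-c)=0$. Let $$\mathcal M(w)=\{X_I^\top X_I+\sigma(I_t-\bar N)+\sigma^{-1}I_t:\ \bar N\in\bar{\mathcal N}(w+\tilde u/\sigma)\}.$$ **Algorithm (semismooth Newton).** Let $\varrho\in(0,1/2)$, $\nu\in(0,1)$, $\tau\in(0,1]$, $\varpi\in(0,1)$ and $\bar w^0\in\mathbb R^t$. For $j=0,1,\dots$: choose $M_j\in\mathcal M(\bar w^j)$; let $h^j$ be an iterate of the conjugate gradient method for $M_jh=-\nabla\varphi(\bar w^j)$, started at $0$, with $$\|M_jh^j+\nabla\varphi(\bar w^j)\|\le\min\{\nu,\|\nabla\varphi(\bar w^j)\|^{1+\tau}\};$$ let $\iota_j$ be the smallest integer $\iota\ge0$ with $\varphi(\bar w^j+\varpi^{\iota}h^j)\le\varphi(\bar w^j)+\varrho\varpi^{\iota}\langle\nabla\varphi(\bar w^j),h^j\rangle$; put $\bar w^{j+1}=\bar w^j+\varpi^{\iota_j}h^j$. **Theorem.** The function $\varphi$ is continuously differentiable and strongly convex with modulus $1/\sigma$. Every infinite sequence $\{\bar w^j\}$ generated by the algorithm (from an arbitrary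 starting point) converges to the unique minimizer $\hat w$ of $\varphi$ over $\mathbb R^t$, and, as $j\to\infty$, $$\|\bar w^{j+1}-\hat w\|=O\big(\|\bar w^j-\hat w\|^{1+\tau}\big).$$ In particular the rate is at least superlinear, $\|\bar w^{j+1}-\hat w\|=o(\|\bar w^j-\hat w\|)$, and it is quadratic, $\|\bar w^{j+1}-\hat w\|=O(\|\bar w^j-\hat w\|^2)$, if $\tau=1$. -/

import Mathlib

noncomputable section

namespace MTLasso

/-! ### Polyhedra, their projectors, and the generalized HS-Jacobian -/

/-- The polyhedron `{w | B w ≤ c}` in Euclidean space. -/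
def polyhedron {ρ κ : Type} [Fintype κ] (B : Matrix ρ κ ℝ) (c : ρ → ℝ) :
    Set (EuclideanSpace ℝ κ) :=
  {w | ∀ r, B.mulVec w.ofLp r ≤ c r}

/-- `p` is the metric projection of `q` onto the set `C`. -/
def IsProjection {E : Type} [NormedAddCommGroup E] (C : Set E) (q p : E) : Prop :=
  p ∈ C ∧ ∀ z ∈ C, ‖p - q‖ ≤ ‖z - q‖

/-- `μ ≥ 0` is a Lagrange multiplier (KKT conditions) for the projection `p` of `q` onto
`{w | B w ≤ c}`. -/
def IsMultiplier {ρ κ : Type} [Fintype ρ] [Fintype κ] (B : Matrix ρ κ ℝ) (c : ρ → ℝ)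
    (q p : EuclideanSpace ℝ κ) (μ : ρ → ℝ) : Prop :=
  (∀ r, 0 ≤ μ r) ∧
  p.ofLp - q.ofLp + B.transpose.mulVec μ = 0 ∧
  (∀ r, B.mulVec p.ofLp r - c r ≤ 0) ∧
  μ ⬝ᵥ (B.mulVec p.ofLp - c) = 0

/-- The submatrix `B_K` of the rows of `B` indexed by `K`. -/
def rowSub {ρ κ : Type} (B : Matrix ρ κ ℝ) (K : Finset ρ) : Matrix K κ ℝ :=
  B.submatrix (fun r : K => (r : ρ)) id

/-- The generalized HS-Jacobian at `q` of the projector onto `{w | B w ≤ c}`: all matrices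
`I - B_Kᵀ (B_K B_Kᵀ)⁻¹ B_K`, where `K` contains the support of some multiplier, is contained in
the set of active constraints at the projection of `q`, and `B_K` has full row rank. -/
def hsJacobian {ρ κ : Type} [Fintype ρ] [DecidableEq ρ] [Fintype κ] [DecidableEq κ]
    (B : Matrix ρ κ ℝ) (c : ρ → ℝ) (q : EuclideanSpace ℝ κ) : Set (Matrix κ κ ℝ) :=
  {N | ∃ (p : EuclideanSpace ℝ κ) (μ : ρ → ℝ) (K : Finset ρ),
    IsProjection (polyhedron B c) q p ∧
    IsMultiplier B c q p μ ∧
    (∀ r, μ r ≠ 0 → r ∈ K) ∧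
    (∀ r ∈ K, B.mulVec p.ofLp r = c r) ∧
    LinearIndependent ℝ (rowSub B K).row ∧
    N = 1 - (rowSub B K).transpose * (rowSub B K * (rowSub B K).transpose)⁻¹ * rowSub B K}

/-- The Moreau envelope of the indicator function of `C`:
`q ↦ inf_z {½ ‖z - q‖² + χ_C(z)}`, the infimum being over the points of `C`. -/
def moreauIndicator {E : Type} [NormedAddCommGroup E] (C : Set E) (q : E) : ℝ :=
  ⨅ z : C, (1 / 2) * ‖(z : E) - q‖ ^ 2

/-! ### The polyhedral description of the projection onto the `ℓ_{1,∞}`-ball -/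

open Classical in
/-- The matrix `T`: in row `i` the only entry that may be nonzero is `sign Q_{iλ}`, where `λ` is
the smallest column index at which `|Q_{i·}|` is maximal. -/
def leadSign {d n : ℕ} (Q : Matrix (Fin d) (Fin n) ℝ) : Matrix (Fin d) (Fin n) ℝ :=
  Matrix.of fun i j =>
    if IsLeast {k : Fin n | ∀ l, |Q i l| ≤ |Q i k|} j then Real.sign (Q i j) else 0

/-- `F = Diag(sign q)`; the coordinates of `Vec(Q)` are indexed by the pairs `(i, j)`. -/
def matF {d n : ℕ} (Q : Matrix (Fin d) (Fin n) ℝ) :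
    Matrix (Fin d × Fin n) (Fin d × Fin n) ℝ :=
  Matrix.diagonal fun k => Real.sign (Q k.1 k.2)

/-- `E`: row `i` is the vector with entry `T_{iλ_i}` at position `(i, λ_i)` and zero elsewhere. -/
def matE {d n : ℕ} (Q : Matrix (Fin d) (Fin n) ℝ) : Matrix (Fin d) (Fin d × Fin n) ℝ :=
  Matrix.of fun i k => if k.1 = i then leadSign Q i k.2 else 0

/-- `D = F - 𝟏ₙ ⊗ E`: from row `(i, j)` of `F` one subtracts row `i` of `E`. -/
def matD {d n : ℕ} (Q : Matrix (Fin d) (Fin n) ℝ) :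
    Matrix (Fin d × Fin n) (Fin d × Fin n) ℝ :=
  Matrix.of fun p k => matF Q p k - matE Q p.1 k

/-- Index type of the `2nd + 1` rows of `B`. -/
abbrev RowIdx (d n : ℕ) : Type := (Fin d × Fin n) ⊕ (Fin d × Fin n) ⊕ Unit

/-- `B = [-F; D; bᵀ]` with `b = Vec(T)`; all of this depends on the matrix `Q` to be projected. -/
def matB {d n : ℕ} (Q : Matrix (Fin d) (Fin n) ℝ) : Matrix (RowIdx d n) (Fin d × Fin n) ℝ :=
  Matrix.of fun r k => match r with
    | Sum.inl p => - matF Q p k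
    | Sum.inr (Sum.inl p) => matD Q p k
    | Sum.inr (Sum.inr _) => leadSign Q k.1 k.2

/-- `c = [0; γ]`. -/
def vecC (d n : ℕ) (γ : ℝ) : RowIdx d n → ℝ
  | Sum.inl _ => 0
  | Sum.inr (Sum.inl _) => 0
  | Sum.inr (Sum.inr _) => γ

/-- The `ℓ_{1,∞}`-norm `∑_i max_j |W_ij|`. -/
def norm1inf {d n : ℕ} (W : Matrix (Fin d) (Fin n) ℝ) : ℝ := ∑ i, ⨆ j, |W i j|

/-! ### The subproblem of the proximal augmented Lagrangian method -/

/-- The data of one (reduced) subproblem: `n` regression tasks `(X^i, y^i)` with `m i` samples and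
`d` features, the radius `γ > 0`, the index set `I` of the retained entries, the penalty parameter
`σ > 0`, and the given vectors `w̃, ũ`. -/
structure PALSubproblem (d n : ℕ) (m : Fin n → ℕ) where
  X : (i : Fin n) → Matrix (Fin (m i)) (Fin d) ℝ
  y : EuclideanSpace ℝ ((i : Fin n) × Fin (m i))
  γ : ℝ
  γ_pos : 0 < γ
  I : Finset (Fin d × Fin n)
  σ : ℝ
  σ_pos : 0 < σ
  wt : EuclideanSpace ℝ I
  ut : EuclideanSpace ℝ I

namespace PALSubproblem

variable {d n : ℕ} {m : Fin n → ℕ} (P : PALSubproblem d n m)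

/-- The space `ℝ^t`, `t = |I|`. -/
abbrev Space : Type := EuclideanSpace ℝ P.I

/-- `𝒬†`: extension of a vector in `ℝ^t` by zero to a `d × n` matrix. -/
def extend (w : P.Space) : Matrix (Fin d) (Fin n) ℝ :=
  Matrix.of fun i j => if h : (i, j) ∈ P.I then w ⟨(i, j), h⟩ else 0

/-- The columns indexed by `I` of the block diagonal matrix `X = Diag(X^1, …, X^n)`;
the column `(k, j)` multiplies the entry `W_{kj}`. -/
def XI : Matrix ((i : Fin n) × Fin (m i)) P.I ℝ :=
  Matrix.of fun p k => if p.1 = k.1.2 then P.X p.1 p.2 k.1.1 else 0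

/-- `B̄`: the columns indexed by `I` of the matrix `B` belonging to the (extended) point `q`. -/
def Bbar (q : P.Space) : Matrix (RowIdx d n) P.I ℝ :=
  (matB (P.extend q)).submatrix id (fun k : P.I => (k : Fin d × Fin n))

/-- `C̄ = {w | B̄ w ≤ c}`, belonging to the point `q` that is projected. -/
def Cbar (q : P.Space) : Set P.Space := polyhedron (P.Bbar q) (vecC d n P.γ)

/-- The point `w + ũ/σ`. -/
def shift (w : P.Space) : P.Space := w + P.σ⁻¹ • P.ut

/-- The objective function
`φ(w) = ½‖y - X_I w‖² - ‖ũ‖²/(2σ) + σ H_{χ_C̄}(w + ũ/σ) + ‖w - w̃‖²/(2σ)`. -/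
def φ (w : P.Space) : ℝ :=
  (1 / 2) * ‖P.y - WithLp.toLp 2 (P.XI.mulVec w.ofLp)‖ ^ 2
    - 1 / (2 * P.σ) * ‖P.ut‖ ^ 2
    + P.σ * moreauIndicator (P.Cbar (P.shift w)) (P.shift w)
    + 1 / (2 * P.σ) * ‖w - P.wt‖ ^ 2

/-- The surrogate generalized Hessian
`𝓜(w) = {X_Iᵀ X_I + σ (I - N̄) + σ⁻¹ I : N̄ in the HS-Jacobian of Π_C̄ at w + ũ/σ}`. -/
def 𝓜 (w : P.Space) : Set (Matrix P.I P.I ℝ) :=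
  {M | ∃ N ∈ hsJacobian (P.Bbar (P.shift w)) (vecC d n P.γ) (P.shift w),
    M = P.XI.transpose * P.XI + P.σ • (1 - N) + P.σ⁻¹ • (1 : Matrix P.I P.I ℝ)}

lemma sum_extend (z : P.Space) (f : Fin d × Fin n → ℝ) :
    ∑ k : P.I, f k * z k = ∑ k : Fin d × Fin n, f k * P.extend z k.1 k.2 := by
  have h1 : ∀ k : P.I, f k * z k = f k * P.extend z (k : Fin d × Fin n).1 (k : Fin d × Fin n).2 := by
    intro k; simp [extend]
  rw [Finset.sum_congr rfl (fun k _ => h1 k),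
    Finset.sum_coe_sort P.I (fun k => f k * P.extend z k.1 k.2)]
  refine Finset.sum_subset (Finset.subset_univ _) ?_
  intro k _ hk
  simp [extend, hk]

lemma mem_Cbar (q z : P.Space) : z ∈ P.Cbar q ↔
    (∀ i j, 0 ≤ Real.sign (P.extend q i j) * P.extend z i j) ∧
    (∀ i j, Real.sign (P.extend q i j) * P.extend z i j ≤
      ∑ l, leadSign (P.extend q) i l * P.extend z i l) ∧
    ∑ i, ∑ l, leadSign (P.extend q) i l * P.extend z i l ≤ P.γ := by
  have key : ∀ r, (P.Bbar q).mulVec z.ofLp r =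
      ∑ k : Fin d × Fin n, matB (P.extend q) r k * P.extend z k.1 k.2 := by
    intro r
    rw [← sum_extend]
    rfl
  have hF : ∀ i j, ∑ k : Fin d × Fin n, matF (P.extend q) (i, j) k * P.extend z k.1 k.2 =
      Real.sign (P.extend q i j) * P.extend z i j := by
    intro i j
    simp [matF, Matrix.diagonal_apply]
  have hE : ∀ i, ∑ k : Fin d × Fin n, matE (P.extend q) i k * P.extend z k.1 k.2 =
      ∑ l, leadSign (P.extend q) i l * P.extend z i l := by
    intro i
    rw [Fintype.sum_prod_type, Finset.sum_eq_single i]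
    · simp [matE]
    · intro b _ hb; simp [matE, hb]
    · simp
  constructor
  · intro h
    refine ⟨fun i j => ?_, fun i j => ?_, ?_⟩
    · have := h (Sum.inl (i, j))
      rw [key] at this
      simp only [matB, Matrix.of_apply, neg_mul, Finset.sum_neg_distrib, vecC] at this
      rw [hF] at this; linarith
    · have := h (Sum.inr (Sum.inl (i, j)))
      rw [key] at this
      simp only [matB, matD, Matrix.of_apply, sub_mul, Finset.sum_sub_distrib, vecC] at this
      rw [hF, hE] at this; linarith
    · have := h (Sum.inr (Sum.inr ()))
      rw [key, Fintype.sum_prod_type] at this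
      exact this
  · rintro ⟨h1, h2, h3⟩ (⟨i, j⟩ | ⟨i, j⟩ | u)
    · rw [key]
      simp only [matB, Matrix.of_apply, neg_mul, Finset.sum_neg_distrib, vecC]
      rw [hF]; linarith [h1 i j]
    · rw [key]
      simp only [matB, matD, Matrix.of_apply, sub_mul, Finset.sum_sub_distrib, vecC]
      rw [hF, hE]; linarith [h2 i j]
    · rw [key, Fintype.sum_prod_type]
      exact h3

lemma leadSign_sum (Q : Matrix (Fin d) (Fin n) ℝ) (i : Fin d) (j : Fin n) :
    ∃ a, (∀ l, |Q i l| ≤ |Q i a|) ∧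
      ∀ Z : Fin n → ℝ, ∑ l, leadSign Q i l * Z l = Real.sign (Q i a) * Z a := by
  have hne : {k : Fin n | ∀ l, |Q i l| ≤ |Q i k|}.Nonempty := by
    have : Nonempty (Fin n) := ⟨j⟩
    obtain ⟨k, hk⟩ := Finite.exists_max (fun l => |Q i l|)
    exact ⟨k, hk⟩
  obtain ⟨a, ha⟩ : ∃ a, IsLeast {k : Fin n | ∀ l, |Q i l| ≤ |Q i k|} a :=
    ⟨_, WellFounded.min_mem wellFounded_lt _ hne,
      fun b hb => not_lt.1 (WellFounded.not_lt_min wellFounded_lt _ hb)⟩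
  refine ⟨a, ha.1, fun Z => ?_⟩
  rw [Finset.sum_eq_single a]
  · simp [leadSign, ha]
  · intro b _ hb
    have : ¬ IsLeast {k : Fin n | ∀ l, |Q i l| ≤ |Q i k|} b := fun h => hb (h.unique ha)
    simp only [leadSign, Matrix.of_apply, if_neg this, zero_mul]
  · simp

/-- Although `C̄` depends on the point `q` to be projected, the Moreau envelope of its indicator at `q`
is that of the fixed convex set `{z | ‖𝒬† z‖_{1,∞} ≤ γ}`. -/
theorem moreauIndicator_Cbar (q : P.Space) :
    moreauIndicator (P.Cbar q) q =
      moreauIndicator {z : P.Space | norm1inf (P.extend z) ≤ P.γ} q := by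
  have bdd : ∀ C : Set P.Space,
      BddBelow (Set.range fun z : C => (1 / 2) * ‖(z : P.Space) - q‖ ^ 2) :=
    fun C => ⟨0, by rintro _ ⟨z, rfl⟩; positivity⟩
  have mono : ∀ C C' : Set P.Space, C'.Nonempty →
      (∀ z ∈ C', ∃ z' ∈ C, ‖z' - q‖ ≤ ‖z - q‖) → moreauIndicator C q ≤ moreauIndicator C' q := by
    intro C C' hn h
    have : Nonempty C' := hn.to_subtype
    refine le_ciInf fun z => ?_
    obtain ⟨z', hz', hle⟩ := h z z.2
    refine (ciInf_le (bdd C) ⟨z', hz'⟩).trans ?_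
    dsimp only
    gcongr
  have e0 : P.extend 0 = 0 := by ext i j; simp [extend]
  have nle : ∀ z z' : P.Space, (∀ k, |z' k - q k| ≤ |z k - q k|) → ‖z' - q‖ ≤ ‖z - q‖ := by
    intro z z' h
    rw [EuclideanSpace.norm_eq, EuclideanSpace.norm_eq]
    refine Real.sqrt_le_sqrt (Finset.sum_le_sum fun k _ => ?_)
    have := h k
    simp only [PiLp.sub_apply, Real.norm_eq_abs]
    gcongr
  apply le_antisymm
  · refine mono _ _ ⟨0, ?_⟩ ?_
    · simp [e0, norm1inf, P.γ_pos.le]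
    · intro z hz
      let θ : Fin d → ℝ := fun i => ⨆ j, |P.extend z i j|
      have hθ : ∀ i j, |P.extend z i j| ≤ θ i := fun i j =>
        le_ciSup (f := fun j => |P.extend z i j|) (Set.finite_range _).bddAbove j
      have hθ0 : ∀ i, 0 ≤ θ i := fun i => Real.iSup_nonneg fun j => abs_nonneg _
      let z' : P.Space := WithLp.toLp 2 fun k => Real.sign (q k) * min |q k| (θ k.1.1)
      have hz' : ∀ i j, P.extend z' i j =
          Real.sign (P.extend q i j) * min |P.extend q i j| (θ i) := by
        intro i j
        by_cases h : (i, j) ∈ P.I <;> simp [extend, h, z']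
      have hs : ∀ i j, Real.sign (P.extend q i j) * P.extend z' i j =
          min |P.extend q i j| (θ i) := by
        intro i j
        rw [hz']
        rcases lt_trichotomy (P.extend q i j) 0 with h | h | h
        · simp [Real.sign_of_neg h]
        · simp [h, hθ0]
        · simp [Real.sign_of_pos h]
      refine ⟨z', (P.mem_Cbar q z').2 ⟨fun i j => ?_, fun i j => ?_, ?_⟩, nle _ _ fun k => ?_⟩
      · rw [hs]; exact le_min (abs_nonneg _) (hθ0 i)
      · obtain ⟨a, ha, hsum⟩ := leadSign_sum (P.extend q) i j
        rw [hsum (fun l => P.extend z' i l), hs, hs]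
        exact min_le_min_right _ (ha j)
      · refine (Finset.sum_le_sum fun i _ => ?_).trans hz
        by_cases hn : Nonempty (Fin n)
        · obtain ⟨j⟩ := hn
          obtain ⟨a, ha, hsum⟩ := leadSign_sum (P.extend q) i j
          rw [hsum (fun l => P.extend z' i l), hs]
          exact min_le_right _ _
        · rw [not_nonempty_iff] at hn
          rw [Finset.univ_eq_empty, Finset.sum_empty]
          exact hθ0 i
      · have h1 := hθ k.1.1 k.1.2
        have h2 : P.extend z k.1.1 k.1.2 = z k := by simp [extend]
        rw [h2] at h1
        have h3 := abs_le.1 h1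
        change |Real.sign (q k) * min |q k| (θ k.1.1) - q k| ≤ _
        rcases lt_trichotomy (q k) 0 with h | h | h
        · rw [Real.sign_of_neg h, abs_of_neg h]
          rcases le_total (-q k) (θ k.1.1) with h4 | h4
          · simp [min_eq_left h4]
          · rw [min_eq_right h4]
            exact abs_le_abs (by linarith) (by linarith)
        · simp [h]
        · rw [Real.sign_of_pos h, abs_of_pos h]
          rcases le_total (q k) (θ k.1.1) with h4 | h4
          · simp [min_eq_left h4]
          · rw [min_eq_right h4, abs_sub_comm, abs_sub_comm (z k)]
            exact abs_le_abs (by linarith) (by linarith)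
  · refine mono _ _ ⟨0, ?_⟩ ?_
    · rw [mem_Cbar]; simp [e0, P.γ_pos.le]
    · intro z hz
      obtain ⟨h1, h2, h3⟩ := (P.mem_Cbar q z).1 hz
      let z' : P.Space := WithLp.toLp 2 fun k => if q k = 0 then 0 else z k
      have hz' : ∀ i j, P.extend z' i j = if P.extend q i j = 0 then 0 else P.extend z i j := by
        intro i j
        by_cases h : (i, j) ∈ P.I <;> simp [extend, h, z']
      refine ⟨z', ?_, nle _ _ fun k => ?_⟩
      · refine le_trans (Finset.sum_le_sum fun i _ => ?_) h3
        by_cases hn : Nonempty (Fin n)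
        · refine ciSup_le fun j => ?_
          rw [hz']
          split_ifs with h
          · rw [abs_zero]; exact (h1 i j).trans (h2 i j)
          · refine le_trans (le_of_eq ?_) (h2 i j)
            have := h1 i j
            rcases lt_or_gt_of_ne h with h | h
            · rw [Real.sign_of_neg h] at this ⊢
              rw [abs_of_nonpos (by linarith)]; ring
            · rw [Real.sign_of_pos h] at this ⊢
              rw [abs_of_nonneg (by linarith)]; ring
        · rw [not_nonempty_iff] at hn
          rw [Real.iSup_of_isEmpty, Finset.univ_eq_empty, Finset.sum_empty]
      · change |(if q k = 0 then 0 else z k) - q k| ≤ _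
        split_ifs with h
        · simp [h]
        · exact le_rfl
end PALSubproblem

/-! ### The conjugate gradient method -/

/-- State of the conjugate gradient method: iterate, residual, search direction. -/
structure CGState (E : Type) where
  x : E
  r : E
  p : E

/-- One step of the conjugate gradient method for `A x = b`. After the residual has become zero
the quotients are `0 / _ = 0`, and the iterate no longer changes. -/
def cgStep {E : Type} [NormedAddCommGroup E] [InnerProductSpace ℝ E] (A : E → E)
    (s : CGState E) : CGState E :=
  let a := inner ℝ s.r s.r / inner ℝ s.p (A s.p)
  let r' := s.r - a • A s.p
  let b := inner ℝ r' r' / inner ℝ s.r s.r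
  { x := s.x + a • s.p, r := r', p := r' + b • s.p }

/-- The conjugate gradient method for `A x = b`, started at `x = 0`. -/
def cgState {E : Type} [NormedAddCommGroup E] [InnerProductSpace ℝ E] (A : E → E) (b : E) :
    ℕ → CGState E
  | 0 => { x := 0, r := b, p := b }
  | k + 1 => cgStep A (cgState A b k)

/-! ### The semismooth Newton algorithm -/

/-- The action of a matrix on Euclidean space. -/
def act {κ : Type} [Fintype κ] (M : Matrix κ κ ℝ) (x : EuclideanSpace ℝ κ) :
    EuclideanSpace ℝ κ :=
  WithLp.toLp 2 (M.mulVec x.ofLp)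

/-- One iteration `w ↦ w'` of the semismooth Newton algorithm: `h` is an iterate of the conjugate
gradient method for `M h = -∇φ(w)` that meets the accuracy test, and the step length is found by
Armijo backtracking. -/
def IsSsnStep {d n : ℕ} {m : Fin n → ℕ} (P : PALSubproblem d n m) (ϱ ν τ ϖ : ℝ)
    (w w' : P.Space) : Prop :=
  ∃ M ∈ P.𝓜 w, ∃ h : P.Space,
    (∃ k : ℕ, h = (cgState (act M) (-gradient P.φ w) k).x) ∧
    ‖act M h + gradient P.φ w‖ ≤ min ν (‖gradient P.φ w‖ ^ (1 + τ)) ∧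
    ∃ ι : ℕ,
      IsLeast {i : ℕ | P.φ (w + ϖ ^ i • h) ≤
        P.φ w + ϱ * ϖ ^ i * inner ℝ (gradient P.φ w) h} ι ∧
      w' = w + ϖ ^ ι • h

/-- `w` is an infinite sequence generated by the semismooth Newton algorithm. -/
def IsSsnSequence {d n : ℕ} {m : Fin n → ℕ} (P : PALSubproblem d n m) (ϱ ν τ ϖ : ℝ)
    (w : ℕ → P.Space) : Prop :=
  ∀ j, IsSsnStep P ϱ ν τ ϖ (w j) (w (j + 1))

end MTLasso

end

noncomputable section

namespace MTLasso

open Filter Topology Asymptotics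

/-! The Moreau envelope at `q` over the moving polyhedron `C̄(q)` is that over the fixed
`ℓ_{1,∞}`-ball, so `φ` is a least-squares term plus `σ` times a smooth convex envelope plus a
proximal quadratic. Its gradient contains the residual `q - proj q` of the ball projector, and `φ`
lies between quadratic models of curvatures `l = 1/σ` and `L`; this gives smoothness, strong
convexity and a unique minimizer.

Global convergence: any conjugate gradient iterate but the zeroth does at least as well on the
Newton model as one exact steepest descent step, so an accepted direction is one of sufficient
descent. Armijo steps are then bounded below, `φ` drops by a multiple of `‖∇φ‖²`, and strong
convexity turns vanishing gradients into convergence (`QuadraticBounds.tendsto_min`).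

Local rate: the HS-Jacobian linearizes the projector exactly, not just to first order. Each
admissible `K` has a closed region on which the projector is affine with linear part `N`; only
finitely many matrices `B̄` and sets `K` occur, so every region containing a point near `q'`
contains `q'` too. Although `C̄(q)` depends on `q`, for `q` near `q'` both points have the same
projections onto `C̄(q)` and the ball (`IsCompatible.isProjection_Cbar`). Hence near the minimizer
`∇φ` is linear and `φ` quadratic along the segment, for every surrogate Hessian
(`eventually_hessian_linearizes`). The error after a full step is then governed by the CG residual,
of order `1 + τ`, and the exact quadratic expansion makes Armijo accept the full step as `ϱ < 1/2`
(`QuadraticBounds.eventually_step_le`). -/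

/-! ### Descent property of the conjugate gradient method -/

section CG

variable {E : Type} [NormedAddCommGroup E] [InnerProductSpace ℝ E]

/-- The quadratic function minimized by the conjugate gradient method for `A x = b`. -/
def cgEnergy (A : E →ₗ[ℝ] E) (b x : E) : ℝ := (1 / 2) * inner ℝ x (A x) - inner ℝ b x

lemma cgEnergy_add_smul {A : E →ₗ[ℝ] E} (hA : A.IsSymmetric) (b x p : E) (a : ℝ) :
    cgEnergy A b (x + a • p) =
      cgEnergy A b x - a * inner ℝ (b - A x) p + a ^ 2 / 2 * inner ℝ p (A p) := by
  have h1 : inner ℝ x (A p) = inner ℝ (A x) p := (hA x p).symm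
  have h2 : inner ℝ p (A x) = inner ℝ (A x) p := real_inner_comm _ _
  simp only [cgEnergy, map_add, map_smul, inner_add_left, inner_add_right, inner_smul_left,
    inner_smul_right, inner_sub_left, h1, h2, RCLike.conj_to_real]
  ring

/-- The exact line search makes the new residual orthogonal to the old direction, which removes the
`p`-part of the new direction. Conjugacy of the directions is never needed. -/
lemma cgState_invariant {A : E →ₗ[ℝ] E} (hpos : ∀ v, v ≠ 0 → 0 < inner ℝ v (A v)) (b : E) (k : ℕ) :
    (cgState A b k).r = b - A (cgState A b k).x ∧
      inner ℝ (cgState A b k).r (cgState A b k).p =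
        inner ℝ (cgState A b k).r (cgState A b k).r := by
  induction k with
  | zero => simp [cgState]
  | succ k ih =>
    obtain ⟨h1, h2⟩ := ih
    set s := cgState A b k with hs
    have hz : inner ℝ (s.r - (inner ℝ s.r s.r / inner ℝ s.p (A s.p)) • A s.p) s.p = 0 := by
      by_cases hp : s.p = 0
      · simp [hp]
      · have hD := (hpos _ hp).ne'
        rw [inner_sub_left, inner_smul_left, h2, real_inner_comm s.p (A s.p), RCLike.conj_to_real,
          div_mul_cancel₀ _ hD, sub_self]
    constructor
    · simp only [cgState, cgStep, ← hs, map_add, map_smul, h1]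
      abel
    · simp only [cgState, cgStep, ← hs]
      rw [inner_add_right, inner_smul_right, hz, mul_zero, add_zero]

/-- Minimum of the energy along the search direction. If `⟨p, A p⟩ = 0`, division by zero gives step
and decrease `0`. -/
lemma cgEnergy_succ {A : E →ₗ[ℝ] E} (hA : A.IsSymmetric)
    (hpos : ∀ v, v ≠ 0 → 0 < inner ℝ v (A v)) (b : E) (k : ℕ) :
    cgEnergy A b (cgState A b (k + 1)).x = cgEnergy A b (cgState A b k).x -
      inner ℝ (cgState A b k).r (cgState A b k).r ^ 2 /
        (2 * inner ℝ (cgState A b k).p (A (cgState A b k).p)) := by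
  obtain ⟨h1, h2⟩ := cgState_invariant hpos b k
  set s := cgState A b k with hs
  have hx : (cgState A b (k + 1)).x = s.x + (inner ℝ s.r s.r / inner ℝ s.p (A s.p)) • s.p := rfl
  rw [hx, cgEnergy_add_smul hA, ← h1, h2]
  by_cases hD : inner ℝ s.p (A s.p) = 0
  · simp [hD]
  · field_simp
    ring

lemma inner_self_map_nonneg {A : E →ₗ[ℝ] E} (hpos : ∀ v, v ≠ 0 → 0 < inner ℝ v (A v)) (v : E) :
    0 ≤ inner ℝ v (A v) := by
  by_cases hv : v = 0
  · simp [hv]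
  · exact (hpos v hv).le

/-- Every iterate of the conjugate gradient method but the initial one is at least as good as the
first steepest descent step. -/
theorem cgEnergy_cgState_le {A : E →ₗ[ℝ] E} (hA : A.IsSymmetric)
    (hpos : ∀ v, v ≠ 0 → 0 < inner ℝ v (A v)) {L : ℝ} (hL : 0 < L) (hAL : ∀ v, ‖A v‖ ≤ L * ‖v‖)
    (b : E) (k : ℕ) : cgEnergy A b (cgState A b (k + 1)).x ≤ -(‖b‖ ^ 2 / (2 * L)) := by
  induction k with
  | zero =>
    rw [cgEnergy_succ hA hpos]
    by_cases hb : b = 0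
    · simp [cgState, cgEnergy, hb]
    have hD := hpos b hb
    have hD' : inner ℝ b (A b) ≤ L * ‖b‖ ^ 2 := by
      refine (real_inner_le_norm _ _).trans ?_
      have := mul_le_mul_of_nonneg_left (hAL b) (norm_nonneg b)
      nlinarith
    have hn : 0 < ‖b‖ := norm_pos_iff.2 hb
    have key : ‖b‖ ^ 2 / (2 * L) ≤ (‖b‖ ^ 2) ^ 2 / (2 * inner ℝ b (A b)) := by
      rw [div_le_div_iff₀ (by positivity) (by positivity)]
      nlinarith [sq_nonneg ‖b‖]
    simp only [cgState, cgEnergy, map_zero, inner_zero_right, mul_zero, sub_self,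
      real_inner_self_eq_norm_sq]
    linarith
  | succ k ih =>
    rw [cgEnergy_succ hA hpos]
    have := inner_self_map_nonneg hpos (cgState A b (k + 1)).p
    have h2 : 0 ≤ inner ℝ (cgState A b (k + 1)).r (cgState A b (k + 1)).r ^ 2 /
        (2 * inner ℝ (cgState A b (k + 1)).p (A (cgState A b (k + 1)).p)) := by positivity
    linarith

end CG

/-! ### Convergence of the inexact Newton method with exact piecewise linearizations -/

section Newton

variable {E : Type} [NormedAddCommGroup E] [InnerProductSpace ℝ E]

/-- `A` is symmetric, with spectrum in `[l, L]`. -/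
structure IsSpectralBounded (l L : ℝ) (A : E →ₗ[ℝ] E) : Prop where
  symm : A.IsSymmetric
  lower : ∀ v, l * ‖v‖ ^ 2 ≤ inner ℝ v (A v)
  upper : ∀ v, ‖A v‖ ≤ L * ‖v‖

/-- `G` is the gradient of `F`, which is strongly convex with modulus `l` and whose gradient has the
descent constant `L`. -/
structure QuadraticBounds (F : E → ℝ) (G : E → E) (l L : ℝ) : Prop where
  pos : 0 < l
  le : l ≤ L
  lower : ∀ w v, F w + inner ℝ (G w) (v - w) + l / 2 * ‖v - w‖ ^ 2 ≤ F v
  upper : ∀ w v, F v ≤ F w + inner ℝ (G w) (v - w) + L / 2 * ‖v - w‖ ^ 2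

namespace QuadraticBounds

variable {F : E → ℝ} {G : E → E} {l L : ℝ}

/-- The two quadratic models squeeze the first-order remainder to `O(‖v - w‖²)`. -/
lemma hasFDerivAt (H : QuadraticBounds F G l L) (w : E) :
    HasFDerivAt F (innerSL ℝ (G w)) w := by
  rw [hasFDerivAt_iff_isLittleO]
  have hL : 0 < L := H.pos.trans_le H.le
  have hO : (fun v => F v - F w - innerSL ℝ (G w) (v - w)) =O[𝓝 w] fun v => ‖v - w‖ ^ 2 := by
    refine IsBigO.of_bound (L / 2) (Eventually.of_forall fun v => ?_)
    have h1 := H.lower w v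
    have h2 := H.upper w v
    have h3 : 0 ≤ l / 2 * ‖v - w‖ ^ 2 := by have := H.pos; positivity
    have h4 : 0 ≤ L / 2 * ‖v - w‖ ^ 2 := by positivity
    rw [innerSL_apply_apply, Real.norm_eq_abs, Real.norm_eq_abs, abs_of_nonneg (sq_nonneg ‖v - w‖),
      abs_le]
    constructor <;> linarith
  refine hO.trans_isLittleO ?_
  have h0 : Tendsto (fun v => ‖v - w‖) (𝓝 w) (𝓝 0) := by
    have : Continuous fun v => ‖v - w‖ := by fun_prop
    simpa using this.tendsto w
  have : (fun v => ‖v - w‖ ^ 2) =o[𝓝 w] fun v => ‖v - w‖ := by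
    simp only [sq]
    simpa using ((isLittleO_one_iff ℝ).2 h0).mul_isBigO (isBigO_refl (fun v => ‖v - w‖) (𝓝 w))
  exact this.trans_isBigO (isBigO_refl _ _).norm_left

lemma contDiff_one (H : QuadraticBounds F G l L) (hG : Continuous G) : ContDiff ℝ 1 F := by
  rw [contDiff_one_iff_fderiv]
  refine ⟨fun w => (H.hasFDerivAt w).differentiableAt, ?_⟩
  have : fderiv ℝ F = fun w => innerSL ℝ (G w) := funext fun w => (H.hasFDerivAt w).fderiv
  rw [this]
  exact (innerSL ℝ (E := E)).continuous.comp hG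

lemma gradient_eq [CompleteSpace E] (H : QuadraticBounds F G l L) (w : E) : gradient F w = G w := by
  refine HasGradientAt.gradient ?_
  rw [hasGradientAt_iff_hasFDerivAt]
  exact H.hasFDerivAt w

/-- Average the lower models at `z = a x + b y` evaluated at `x` and `y`: the gradient terms cancel
and `a b² + b a² = a b`. -/
lemma strongConvexOn (H : QuadraticBounds F G l L) : StrongConvexOn Set.univ l F := by
  refine ⟨convex_univ, fun x _ y _ a b ha hb hab => ?_⟩
  set z := a • x + b • y with hz
  have hx : x - z = b • (x - y) := by
    rw [hz, show a = 1 - b by linarith]; module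
  have hy : y - z = -(a • (x - y)) := by
    rw [hz, show b = 1 - a by linarith]; module
  have h1 := H.lower z x
  have h2 := H.lower z y
  rw [hx, inner_smul_right, norm_smul, mul_pow, Real.norm_eq_abs, sq_abs] at h1
  rw [hy, inner_neg_right, inner_smul_right, norm_neg, norm_smul, mul_pow, Real.norm_eq_abs,
    sq_abs] at h2
  have h3 := add_le_add (mul_le_mul_of_nonneg_left h1 ha) (mul_le_mul_of_nonneg_left h2 hb)
  have hb' : b = 1 - a := by linarith
  simp only [smul_eq_mul]
  refine le_trans (le_of_eq ?_) (sub_le_sub_right h3 _)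
  subst hb'
  ring

lemma eq_zero_of_isMin (H : QuadraticBounds F G l L) {what : E} (hmin : ∀ v, F what ≤ F v) :
    G what = 0 := by
  have := IsLocalMin.hasFDerivAt_eq_zero
    (Filter.Eventually.of_forall hmin : IsLocalMin F what) (H.hasFDerivAt what)
  have h := congrArg (fun f => f (G what)) this
  simpa using h

/-- Adding the lower models at `w` and at the minimizer gives `⟨G w, w - what⟩ ≥ l ‖w - what‖²`;
then Cauchy–Schwarz. This error bound also yields uniqueness of the minimizer. -/
lemma norm_le (H : QuadraticBounds F G l L) {what : E} (hmin : ∀ v, F what ≤ F v) (w : E) :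
    l * ‖w - what‖ ≤ ‖G w‖ := by
  have h1 := H.lower w what
  have h3 : F what ≤ F w - l / 2 * ‖w - what‖ ^ 2 := by
    have := H.lower what w
    rw [H.eq_zero_of_isMin hmin, inner_zero_left] at this
    linarith
  have h4 : inner ℝ (G w) (what - w) = - inner ℝ (G w) (w - what) := by
    rw [← inner_neg_right, neg_sub]
  rw [h4, norm_sub_rev what w] at h1
  have h5 := real_inner_le_norm (G w) (w - what)
  by_contra! hc
  have hp : 0 < ‖w - what‖ := by
    by_contra! h0
    have := le_antisymm h0 (norm_nonneg _)
    rw [this, mul_zero] at hc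
    exact absurd hc (not_lt.2 (norm_nonneg _))
  nlinarith [mul_lt_mul_of_pos_right hc hp]

lemma exists_min [FiniteDimensional ℝ E] (H : QuadraticBounds F G l L) :
    ∃ what, ∀ v, F what ≤ F v := by
  have hc : Continuous F := continuous_iff_continuousAt.2 fun w => (H.hasFDerivAt w).continuousAt
  refine hc.exists_forall_le ?_
  have h1 : Tendsto (fun x : ℝ => F 0 + x * (l / 2 * x - ‖G 0‖)) atTop atTop := by
    refine tendsto_atTop_add_const_left _ _ (tendsto_id.atTop_mul_atTop₀ ?_)
    exact tendsto_atTop_add_const_right _ _ (tendsto_id.const_mul_atTop (by linarith [H.pos]))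
  refine tendsto_atTop_mono (fun v => ?_) (h1.comp (tendsto_norm_cocompact_atTop (E := E)))
  have h2 := H.lower 0 v
  have h3 := neg_le_of_abs_le (abs_real_inner_le_norm (G 0) v)
  simp only [sub_zero] at h2
  simp only [Function.comp]
  nlinarith

/-- The search direction is a sufficient descent direction. -/
lemma inner_direction_le {A : E →ₗ[ℝ] E} (hl : 0 < l) (hlL : l ≤ L) (hA : IsSpectralBounded l L A)
    {ν τ : ℝ} (hν : ν < 1) (hτ : 0 < τ) {g h : E} {k : ℕ} (hk : h = (cgState A (-g) k).x)
    (hres : ‖A h + g‖ ≤ min ν (‖g‖ ^ (1 + τ))) :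
    inner ℝ g h ≤ -(l / 2 * ‖h‖ ^ 2) ∧ inner ℝ g h ≤ -(‖g‖ ^ 2 / (2 * L)) := by
  have hL : 0 < L := hl.trans_le hlL
  cases k with
  | zero =>
    have h0 : h = 0 := hk
    -- The zero iterate passes the accuracy test only at a stationary point: otherwise `‖g‖ ≤ ν <
    -- 1`, so `‖g‖ ^ (1 + τ) < ‖g‖`.
    have hg : g = 0 := by
      by_contra hg
      have hp : 0 < ‖g‖ := norm_pos_iff.2 hg
      rw [h0, map_zero, zero_add] at hres
      have h1 : ‖g‖ < 1 := (hres.trans (min_le_left _ _)).trans_lt hν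
      have h2 := hres.trans (min_le_right _ _)
      rw [Real.rpow_add hp, Real.rpow_one] at h2
      have h3 := Real.rpow_lt_one hp.le h1 hτ
      nlinarith
    simp [h0, hg]
  | succ k =>
    have hpos : ∀ v, v ≠ 0 → 0 < inner ℝ v (A v) := fun v hv =>
      lt_of_lt_of_le (mul_pos hl (pow_pos (norm_pos_iff.2 hv) 2)) (hA.lower v)
    -- This reads `½⟨h, A h⟩ + ⟨g, h⟩ ≤ -‖g‖²/(2L)`; dropping either quadratic term gives one of the
    -- two bounds.
    have h1 := cgEnergy_cgState_le hA.symm hpos hL hA.upper (-g) k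
    rw [← hk, cgEnergy, norm_neg, inner_neg_left] at h1
    have h2 := hA.lower h
    have h3 : 0 ≤ ‖g‖ ^ 2 / (2 * L) := by positivity
    have h4 : 0 ≤ l * ‖h‖ ^ 2 := by positivity
    constructor <;> linarith

/-- The step lengths found by Armijo backtracking are bounded away from zero. -/
lemma le_stepLength (H : QuadraticBounds F G l L) {ϱ ϖ : ℝ} (hϱ : 0 < ϱ ∧ ϱ < 1 / 2)
    (hϖ : 0 < ϖ ∧ ϖ < 1) {w h : E} (hd : inner ℝ (G w) h ≤ -(l / 2 * ‖h‖ ^ 2)) {ι : ℕ}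
    (hι : IsLeast {i : ℕ | F (w + ϖ ^ i • h) ≤ F w + ϱ * ϖ ^ i * inner ℝ (G w) h} ι) :
    ϖ * ((1 - ϱ) * (l / L)) ≤ ϖ ^ ι := by
  have hl := H.pos
  have hL : 0 < L := hl.trans_le H.le
  have hlL : l / L ≤ 1 := (div_le_one hL).2 H.le
  have hlL0 : 0 < l / L := by positivity
  cases ι with
  | zero =>
    rw [pow_zero]
    have : (1 - ϱ) * (l / L) ≤ 1 := by nlinarith
    nlinarith
  | succ i =>
    -- The last rejected trial `t = ϖ ^ i` violates Armijo but obeys the upper model, which forces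
    -- `L t > (1 - ϱ) l`; the accepted step is `ϖ t`.
    have hi : ¬ F (w + ϖ ^ i • h) ≤ F w + ϱ * ϖ ^ i * inner ℝ (G w) h := fun hc =>
      absurd (hι.2 hc) (by simp)
    push Not at hi
    have hu := H.upper w (w + ϖ ^ i • h)
    rw [add_sub_cancel_left, inner_smul_right, norm_smul, mul_pow, Real.norm_eq_abs, sq_abs] at hu
    have ht : 0 < ϖ ^ i := pow_pos hϖ.1 i
    set t := ϖ ^ i
    have h1 : 0 < t * ((1 - ϱ) * inner ℝ (G w) h + L / 2 * t * ‖h‖ ^ 2) := by nlinarith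
    have h2 := pos_of_mul_pos_right h1 ht.le
    have h3 : 0 < (L * t - (1 - ϱ) * l) * ‖h‖ ^ 2 := by nlinarith
    have h4 := pos_of_mul_pos_left h3 (sq_nonneg _)
    rw [pow_succ, mul_comm]
    refine mul_le_mul_of_nonneg_right ?_ hϖ.1.le
    rw [← mul_div_assoc, div_le_iff₀ hL]
    linarith

/-- One step of the inexact Newton method. -/
def IsNewtonStep (F : E → ℝ) (G : E → E) (Ms : E → Set (E →ₗ[ℝ] E)) (ϱ ν τ ϖ : ℝ) (w w' : E) :
    Prop :=
  ∃ A ∈ Ms w, ∃ h : E, (∃ k : ℕ, h = (cgState A (-G w) k).x) ∧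
    ‖A h + G w‖ ≤ min ν (‖G w‖ ^ (1 + τ)) ∧
    ∃ ι : ℕ, IsLeast {i : ℕ | F (w + ϖ ^ i • h) ≤ F w + ϱ * ϖ ^ i * inner ℝ (G w) h} ι ∧
      w' = w + ϖ ^ ι • h

variable {Ms : E → Set (E →ₗ[ℝ] E)} {ϱ ν τ ϖ : ℝ}

lemma step_decrease (H : QuadraticBounds F G l L) (hM : ∀ w, ∀ A ∈ Ms w, IsSpectralBounded l L A)
    (hϱ : 0 < ϱ ∧ ϱ < 1 / 2) (hν : ν < 1) (hτ : 0 < τ) (hϖ : 0 < ϖ ∧ ϖ < 1) {w w' : E}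
    (hs : IsNewtonStep F G Ms ϱ ν τ ϖ w w') :
    ϱ * (ϖ * ((1 - ϱ) * (l / L))) * (‖G w‖ ^ 2 / (2 * L)) ≤ F w - F w' := by
  obtain ⟨A, hA, h, ⟨k, hk⟩, hres, ι, hι, rfl⟩ := hs
  obtain ⟨h1, h2⟩ := inner_direction_le H.pos H.le (hM w A hA) hν hτ hk hres
  have h3 := H.le_stepLength hϱ hϖ h1 hι
  have h4 : F (w + ϖ ^ ι • h) ≤ F w + ϱ * ϖ ^ ι * inner ℝ (G w) h := hι.1
  have hL : 0 < L := H.pos.trans_le H.le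
  have h5 : 0 ≤ ‖G w‖ ^ 2 / (2 * L) := by positivity
  have h6 : ϱ * (ϖ * ((1 - ϱ) * (l / L))) * (‖G w‖ ^ 2 / (2 * L)) ≤
      ϱ * ϖ ^ ι * (‖G w‖ ^ 2 / (2 * L)) :=
    mul_le_mul_of_nonneg_right (mul_le_mul_of_nonneg_left h3 hϱ.1.le) h5
  have h7 : ϱ * ϖ ^ ι * (‖G w‖ ^ 2 / (2 * L)) ≤ ϱ * ϖ ^ ι * (-inner ℝ (G w) h) :=
    mul_le_mul_of_nonneg_left (by linarith) (mul_nonneg hϱ.1.le (pow_nonneg hϖ.1.le _))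
  linarith

/-- The values of `F` decrease and are bounded below, so their differences vanish; these dominate `c
‖G‖² ≥ c l² ‖w - what‖²`. -/
lemma tendsto_min (H : QuadraticBounds F G l L) (hM : ∀ w, ∀ A ∈ Ms w, IsSpectralBounded l L A)
    (hϱ : 0 < ϱ ∧ ϱ < 1 / 2) (hν : ν < 1) (hτ : 0 < τ) (hϖ : 0 < ϖ ∧ ϖ < 1) {w : ℕ → E}
    (hs : ∀ j, IsNewtonStep F G Ms ϱ ν τ ϖ (w j) (w (j + 1))) {what : E}
    (hmin : ∀ v, F what ≤ F v) : Tendsto w atTop (𝓝 what) := by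
  have hl := H.pos
  have hL : 0 < L := hl.trans_le H.le
  have hϱ1 : 0 < 1 - ϱ := by linarith [hϱ.2]
  set c := ϱ * (ϖ * ((1 - ϱ) * (l / L))) / (2 * L) with hc
  have hc0 : 0 < c := by
    have := hϱ.1
    have := hϖ.1
    positivity
  have hdec : ∀ j, c * ‖G (w j)‖ ^ 2 ≤ F (w j) - F (w (j + 1)) := fun j => by
    refine le_trans (le_of_eq ?_) (H.step_decrease hM hϱ hν hτ hϖ (hs j))
    rw [hc]; ring
  have hanti : Antitone fun j => F (w j) := antitone_nat_of_succ_le fun j => by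
    have := hdec j
    have : 0 ≤ c * ‖G (w j)‖ ^ 2 := by positivity
    linarith
  have hlim := tendsto_atTop_ciInf hanti ⟨F what, by rintro _ ⟨j, rfl⟩; exact hmin _⟩
  have hdiff : Tendsto (fun j => (F (w j) - F (w (j + 1))) / (c * l ^ 2)) atTop (𝓝 0) := by
    have := (hlim.sub (hlim.comp (tendsto_add_atTop_nat 1))).div_const (c * l ^ 2)
    simpa using this
  have hsq : Tendsto (fun j => ‖w j - what‖ ^ 2) atTop (𝓝 0) := by
    refine squeeze_zero (fun j => sq_nonneg _) (fun j => ?_) hdiff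
    rw [le_div_iff₀ (by positivity)]
    refine le_trans (le_of_eq ?_) ((mul_le_mul_of_nonneg_left
      (pow_le_pow_left₀ (by positivity) (H.norm_le hmin (w j)) 2) hc0.le).trans (hdec j))
    ring
  rw [tendsto_iff_norm_sub_tendsto_zero]
  have := hsq.sqrt
  simpa [Real.sqrt_sq] using this

/-- The local estimate: near the minimizer the unit step is accepted and the error is contracted
with order `1 + τ`. -/
lemma eventually_step_le (H : QuadraticBounds F G l L)
    (hM : ∀ w, ∀ A ∈ Ms w, IsSpectralBounded l L A)
    (hϱ : 0 < ϱ ∧ ϱ < 1 / 2) (hτ : 0 < τ) {what : E}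
    (hmin : ∀ v, F what ≤ F v)
    (hlin : ∀ᶠ w in 𝓝 what, ∀ A ∈ Ms w, G w = G what + A (w - what) ∧
      F w = F what + inner ℝ (G what) (w - what) + 1 / 2 * inner ℝ (w - what) (A (w - what))) :
    ∀ᶠ w in 𝓝 what, ∀ w', IsNewtonStep F G Ms ϱ ν τ ϖ w w' →
      ‖w' - what‖ ≤ L ^ (1 + τ) / l * ‖w - what‖ ^ (1 + τ) := by
  have hl := H.pos
  have hL : 0 < L := hl.trans_le H.le
  have hG0 := H.eq_zero_of_isMin hmin
  set C := L ^ (1 + τ) / l with hC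
  have hC0 : 0 < C := by positivity
  have hδ : Tendsto (fun w => C * ‖w - what‖ ^ τ) (𝓝 what) (𝓝 0) := by
    have : Continuous fun w : E => C * ‖w - what‖ ^ τ :=
      continuous_const.mul ((continuous_id.sub continuous_const).norm.rpow_const
        fun _ => Or.inr hτ.le)
    simpa [Real.zero_rpow hτ.ne'] using this.tendsto what
  -- With `δ = C ‖e‖ ^ τ` and `‖s‖ ≤ δ ‖e‖`, this is the Armijo test for the unit step divided by
  -- `‖e‖²`.
  have hq : ∀ᶠ w in 𝓝 what, ϱ * L * (C * ‖w - what‖ ^ τ) + L / 2 * (C * ‖w - what‖ ^ τ) ^ 2 <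
      (1 / 2 - ϱ) * l := by
    have h1 := (hδ.const_mul (ϱ * L)).add ((hδ.pow 2).const_mul (L / 2))
    have h0 : 0 < (1 / 2 - ϱ) * l := mul_pos (by linarith [hϱ.2]) hl
    exact h1.eventually (gt_mem_nhds (by simpa using h0))
  filter_upwards [hlin, hq] with w hlw hqw w' hs
  obtain ⟨A, hA, h, -, hres, ι, hι, rfl⟩ := hs
  obtain ⟨hGw, hFw⟩ := hlw A hA
  have hAb := hM w A hA
  rw [hG0, zero_add] at hGw
  rw [hG0, inner_zero_left, add_zero] at hFw
  set e := w - what with he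
  set s := w + h - what with hsdef
  have hse : h = s - e := by rw [hsdef, he]; abel
  -- Since `G w = A e` exactly, the error `s` of the full step is mapped by `A` to the CG residual.
  have hAs : A s = A h + G w := by rw [hGw, ← map_add, hse, sub_add_cancel]
  have hGe : ‖G w‖ ≤ L * ‖e‖ := hGw ▸ hAb.upper e
  have hls : l * ‖s‖ ≤ ‖A s‖ := by
    have h1 := (hAb.lower s).trans (real_inner_le_norm _ _)
    by_cases hs0 : ‖s‖ = 0
    · rw [hs0, mul_zero]; exact norm_nonneg _
    · have hp : 0 < ‖s‖ := lt_of_le_of_ne (norm_nonneg _) (Ne.symm hs0)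
      refine le_of_mul_le_mul_left ?_ hp
      linarith [mul_comm ‖s‖ (l * ‖s‖), sq ‖s‖, mul_assoc l ‖s‖ ‖s‖]
  have hsC : ‖s‖ ≤ C * ‖e‖ ^ (1 + τ) := by
    rw [hC, div_mul_eq_mul_div, le_div_iff₀ hl, ← Real.mul_rpow hL.le (norm_nonneg _), mul_comm]
    refine hls.trans ?_
    rw [hAs]
    exact (hres.trans (min_le_right _ _)).trans
      (Real.rpow_le_rpow (norm_nonneg _) hGe (by linarith))
  have hsδ : ‖s‖ ≤ C * ‖e‖ ^ τ * ‖e‖ := by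
    by_cases h0 : ‖e‖ = 0
    · rw [h0] at hsC ⊢
      rw [Real.zero_rpow (by linarith)] at hsC
      simpa using hsC
    · rw [Real.rpow_add (lt_of_le_of_ne (norm_nonneg _) (Ne.symm h0)), Real.rpow_one] at hsC
      linarith [mul_comm (‖e‖) (‖e‖ ^ τ), mul_assoc C (‖e‖ ^ τ) ‖e‖]
  -- With `F w = F what + ½⟨e, A e⟩` and `F (w + h) ≤ F what + L/2 ‖s‖²`, what is needed is `L/2
  -- ‖s‖² ≤ (½ - ϱ)⟨e, A e⟩ + ϱ⟨A e, s⟩`.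
  have hacc : F (w + ϖ ^ 0 • h) ≤ F w + ϱ * ϖ ^ 0 * inner ℝ (G w) h := by
    rw [pow_zero, one_smul, mul_one]
    have h1 := H.upper what (w + h)
    rw [hG0, inner_zero_left, add_zero, ← hsdef] at h1
    have h2 : inner ℝ (G w) h = inner ℝ (A e) s - inner ℝ e (A e) := by
      rw [hGw, hse, inner_sub_right, real_inner_comm e (A e)]
    have h3 := hAb.lower e
    have h4 : -(L * ‖e‖ * ‖s‖) ≤ inner ℝ (A e) s := by
      refine le_trans (neg_le_neg ?_) (neg_le_of_abs_le (abs_real_inner_le_norm (A e) s))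
      exact mul_le_mul_of_nonneg_right (hAb.upper e) (norm_nonneg _)
    set δ := C * ‖e‖ ^ τ with hδdef
    have hδ0 : 0 ≤ δ := by positivity
    have h5 : ‖e‖ * ‖s‖ ≤ δ * ‖e‖ ^ 2 := by nlinarith [norm_nonneg e]
    have h6 : ‖s‖ ^ 2 ≤ δ ^ 2 * ‖e‖ ^ 2 := by
      rw [← mul_pow]; exact pow_le_pow_left₀ (norm_nonneg _) hsδ 2
    have h7 : (ϱ * L * δ + L / 2 * δ ^ 2) * ‖e‖ ^ 2 ≤ (1 / 2 - ϱ) * l * ‖e‖ ^ 2 :=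
      mul_le_mul_of_nonneg_right hqw.le (sq_nonneg _)
    have h8 : (1 / 2 - ϱ) * (l * ‖e‖ ^ 2) ≤ (1 / 2 - ϱ) * inner ℝ e (A e) :=
      mul_le_mul_of_nonneg_left h3 (by linarith [hϱ.2])
    have h9 : ϱ * -(L * ‖e‖ * ‖s‖) ≤ ϱ * inner ℝ (A e) s := mul_le_mul_of_nonneg_left h4 hϱ.1.le
    have h10 : ϱ * L * (‖e‖ * ‖s‖) ≤ ϱ * L * (δ * ‖e‖ ^ 2) :=
      mul_le_mul_of_nonneg_left h5 (mul_nonneg hϱ.1.le hL.le)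
    have h11 : L / 2 * ‖s‖ ^ 2 ≤ L / 2 * (δ ^ 2 * ‖e‖ ^ 2) :=
      mul_le_mul_of_nonneg_left h6 (by positivity)
    rw [h2]
    linarith
  have hι0 : ι = 0 := Nat.le_zero.1 (hι.2 hacc)
  rw [hι0, pow_zero, one_smul]
  exact hsC

/-- The exact expansion is assumed at every point because the minimizer is only produced inside. -/
theorem newton_convergence [FiniteDimensional ℝ E] (H : QuadraticBounds F G l L)
    (hM : ∀ w, ∀ A ∈ Ms w, IsSpectralBounded l L A)
    (hlin : ∀ what, ∀ᶠ w in 𝓝 what, ∀ A ∈ Ms w, G w = G what + A (w - what) ∧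
      F w = F what + inner ℝ (G what) (w - what) + 1 / 2 * inner ℝ (w - what) (A (w - what)))
    (hϱ : 0 < ϱ ∧ ϱ < 1 / 2) (hν : ν < 1) (hτ : 0 < τ) (hϖ : 0 < ϖ ∧ ϖ < 1) {w : ℕ → E}
    (hs : ∀ j, IsNewtonStep F G Ms ϱ ν τ ϖ (w j) (w (j + 1))) :
    ∃ what : E, (∀ v, F what ≤ F v) ∧ (∀ v, (∀ v', F v ≤ F v') → v = what) ∧
      Tendsto w atTop (𝓝 what) ∧
      (fun j => ‖w (j + 1) - what‖) =O[atTop] (fun j => ‖w j - what‖ ^ (1 + τ)) ∧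
      (fun j => ‖w (j + 1) - what‖) =o[atTop] (fun j => ‖w j - what‖) ∧
      (τ = 1 → (fun j => ‖w (j + 1) - what‖) =O[atTop] (fun j => ‖w j - what‖ ^ 2)) := by
  obtain ⟨what, hmin⟩ := H.exists_min
  have hlim := H.tendsto_min hM hϱ hν hτ hϖ hs hmin
  have hO : (fun j => ‖w (j + 1) - what‖) =O[atTop] (fun j => ‖w j - what‖ ^ (1 + τ)) := by
    refine IsBigO.of_bound (L ^ (1 + τ) / l) ?_
    filter_upwards [hlim.eventually
      (H.eventually_step_le (ν := ν) (ϖ := ϖ) hM hϱ hτ hmin (hlin what))]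
      with j hj
    rw [norm_norm, Real.norm_of_nonneg (Real.rpow_nonneg (norm_nonneg _) _)]
    exact hj _ (hs j)
  refine ⟨what, hmin, fun v hv => ?_, hlim, hO, ?_, fun hτ1 => ?_⟩
  · have h1 := H.norm_le hmin v
    rw [H.eq_zero_of_isMin hv, norm_zero] at h1
    have h2 : ‖v - what‖ ≤ 0 := by
      by_contra! hc
      exact absurd h1 (not_le.2 (mul_pos H.pos hc))
    exact sub_eq_zero.1 (norm_le_zero_iff.1 h2)
  · refine hO.trans_isLittleO ?_
    have he : Tendsto (fun j => ‖w j - what‖ ^ τ) atTop (𝓝 0) := by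
      have := (tendsto_iff_norm_sub_tendsto_zero.1 hlim).rpow_const (p := τ) (Or.inr hτ.le)
      simpa [Real.zero_rpow hτ.ne'] using this
    have h1 := ((isLittleO_one_iff ℝ).2 he).mul_isBigO
      (isBigO_refl (fun j => ‖w j - what‖) atTop)
    refine h1.congr (fun j => ?_) fun j => one_mul _
    rw [add_comm, Real.rpow_add' (norm_nonneg _) (by linarith), Real.rpow_one]
  · subst hτ1
    refine hO.congr_right fun j => ?_
    rw [show (1 : ℝ) + 1 = (2 : ℕ) by norm_num, Real.rpow_natCast]

end QuadraticBounds

end Newton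

end MTLasso
end

noncomputable section

namespace MTLasso

open Filter Topology Matrix

/-! ### Metric projections onto convex sets -/

section Projection

variable {E : Type} [NormedAddCommGroup E] {C : Set E}

lemma IsProjection.moreauIndicator_eq {q p : E} (h : IsProjection C q p) :
    moreauIndicator C q = 1 / 2 * ‖q - p‖ ^ 2 := by
  have hne : Nonempty C := ⟨⟨p, h.1⟩⟩
  rw [norm_sub_rev]
  refine le_antisymm (ciInf_le ⟨0, by rintro _ ⟨y, rfl⟩; positivity⟩ (⟨p, h.1⟩ : C)) ?_
  refine le_ciInf fun z => ?_
  have := pow_le_pow_left₀ (norm_nonneg _) (h.2 z z.2) 2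
  linarith

variable [InnerProductSpace ℝ E]

lemma IsProjection.of_inner_le {q p : E} (hp : p ∈ C)
    (h : ∀ z ∈ C, inner ℝ (q - p) (z - p) ≤ 0) : IsProjection C q p := by
  refine ⟨hp, fun z hz => ?_⟩
  have h1 : ‖z - q‖ ^ 2 = ‖z - p‖ ^ 2 - 2 * inner ℝ (q - p) (z - p) + ‖p - q‖ ^ 2 := by
    rw [norm_sub_rev p q, show z - q = (z - p) - (q - p) by abel, norm_sub_sq_real,
      real_inner_comm]
  refine le_of_sq_le_sq ?_ (norm_nonneg _)
  nlinarith [h z hz, sq_nonneg ‖z - p‖]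

lemma IsProjection.inner_le (hC : Convex ℝ C) {q p z : E} (h : IsProjection C q p) (hz : z ∈ C) :
    inner ℝ (q - p) (z - p) ≤ 0 := by
  have hne : Nonempty C := ⟨⟨p, h.1⟩⟩
  refine (norm_eq_iInf_iff_real_inner_le_zero hC h.1).1 (le_antisymm ?_ ?_) z hz
  · refine le_ciInf fun y => ?_
    rw [norm_sub_rev q p, norm_sub_rev q]
    exact h.2 y y.2
  · exact ciInf_le ⟨0, by rintro _ ⟨y, rfl⟩; exact norm_nonneg _⟩ (⟨p, h.1⟩ : C)

lemma IsProjection.unique (hC : Convex ℝ C) {q p p' : E} (h : IsProjection C q p) (hp' : p' ∈ C)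
    (hle : ‖p' - q‖ ≤ ‖p - q‖) : p' = p := by
  have h1 := h.inner_le hC hp'
  have h2 : ‖p' - q‖ ^ 2 = ‖p' - p‖ ^ 2 - 2 * inner ℝ (q - p) (p' - p) + ‖p - q‖ ^ 2 := by
    rw [norm_sub_rev p q, show p' - q = (p' - p) - (q - p) by abel, norm_sub_sq_real,
      real_inner_comm]
  have h3 := pow_le_pow_left₀ (norm_nonneg _) hle 2
  have h4 : ‖p' - p‖ ^ 2 ≤ 0 := by linarith
  exact sub_eq_zero.1 (norm_eq_zero.1 (pow_eq_zero_iff two_ne_zero |>.1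
    (le_antisymm h4 (sq_nonneg _))))

lemma exists_isProjection (hne : C.Nonempty) (hcomp : IsComplete C) (hC : Convex ℝ C) (q : E) :
    ∃ p, IsProjection C q p := by
  obtain ⟨p, hp, h⟩ := exists_norm_eq_iInf_of_complete_convex hne hcomp hC q
  exact ⟨p, .of_inner_le hp ((norm_eq_iInf_iff_real_inner_le_zero hC hp).1 h)⟩

/-- The metric projector onto a closed convex set is nonexpansive. -/
lemma IsProjection.norm_sub_le (hC : Convex ℝ C) {q p q' p' : E} (h : IsProjection C q p)
    (h' : IsProjection C q' p') : ‖p - p'‖ ≤ ‖q - q'‖ := by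
  have h1 := h.inner_le hC h'.1
  have h2 := h'.inner_le hC h.1
  have h3 : inner ℝ (q - p) (p' - p) + inner ℝ (q' - p') (p - p') =
      ‖p - p'‖ ^ 2 - inner ℝ (q - q') (p - p') := by
    rw [← real_inner_self_eq_norm_sq, show p' - p = -(p - p') by abel, inner_neg_right,
      ← sub_eq_neg_add, ← inner_sub_left, ← inner_sub_left]
    congr 1; abel
  have h4 := real_inner_le_norm (q - q') (p - p')
  by_contra! hc
  nlinarith [norm_nonneg (q - q')]

end Projection

/-! ### The affine pieces of the projector onto a polyhedron -/

section Polyhedron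

variable {ρ κ : Type} [Fintype κ]

lemma inner_eq_dotProduct (x y : EuclideanSpace ℝ κ) : inner ℝ x y = x.ofLp ⬝ᵥ y.ofLp := by
  rw [EuclideanSpace.inner_eq_star_dotProduct, dotProduct_comm]
  rfl

variable [DecidableEq ρ]

/-- The multiplier of the projection onto the affine subspace `B_K w = c_K`. -/
def faceMultiplier (B : Matrix ρ κ ℝ) (c : ρ → ℝ) (K : Finset ρ) (q : EuclideanSpace ℝ κ) :
    K → ℝ :=
  (rowSub B K * (rowSub B K)ᵀ)⁻¹ *ᵥ (rowSub B K *ᵥ q.ofLp - fun r : K => c r)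

/-- The projection onto the affine subspace `B_K w = c_K`. -/
def facePoint (B : Matrix ρ κ ℝ) (c : ρ → ℝ) (K : Finset ρ) (q : EuclideanSpace ℝ κ) :
    EuclideanSpace ℝ κ :=
  WithLp.toLp 2 (q.ofLp - (rowSub B K)ᵀ *ᵥ faceMultiplier B c K q)

/-- The points whose projection onto `{w | B w ≤ c}` is that onto `B_K w = c_K`, with nonnegative
multipliers. -/
def faceRegion (B : Matrix ρ κ ℝ) (c : ρ → ℝ) (K : Finset ρ) : Set (EuclideanSpace ℝ κ) :=
  {q | (∀ r, 0 ≤ faceMultiplier B c K q r) ∧ ∀ r, (B *ᵥ (facePoint B c K q).ofLp) r ≤ c r}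

variable {B : Matrix ρ κ ℝ} {c : ρ → ℝ} {K : Finset ρ}

/-- If `x B_K B_Kᵀ = 0` then `‖x B_K‖² = 0`, so independence of the rows gives `x = 0`. -/
lemma isUnit_det_gram (hK : LinearIndependent ℝ (rowSub B K).row) :
    IsUnit (rowSub B K * (rowSub B K)ᵀ).det := by
  rw [← Matrix.isUnit_iff_isUnit_det, ← Matrix.vecMul_injective_iff_isUnit]
  have hinj : Function.Injective (rowSub B K).vecMul := Matrix.vecMul_injective_iff.2 hK
  intro x y hxy
  apply hinj
  rw [← sub_eq_zero, ← Matrix.sub_vecMul]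
  have h1 : (x - y) ᵥ* (rowSub B K * (rowSub B K)ᵀ) = 0 := by
    rw [Matrix.sub_vecMul, sub_eq_zero]; exact hxy
  have h2 : ((x - y) ᵥ* rowSub B K) ⬝ᵥ ((x - y) ᵥ* rowSub B K) = 0 := by
    have := congrArg (fun v => v ⬝ᵥ (x - y)) h1
    simp only [zero_dotProduct, ← Matrix.vecMul_vecMul] at this
    rwa [← Matrix.dotProduct_mulVec, Matrix.mulVec_transpose] at this
  exact dotProduct_self_eq_zero.1 h2

/-- Closedness lets a limit point inherit membership from nearby points. -/
lemma isClosed_faceRegion : IsClosed (faceRegion B c K) := by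
  have h1 : Continuous (faceMultiplier B c K) := by
    unfold faceMultiplier
    exact Continuous.matrix_mulVec continuous_const
      ((Continuous.matrix_mulVec continuous_const (PiLp.continuous_ofLp 2 _)).sub continuous_const)
  have h2 : Continuous fun q => (facePoint B c K q).ofLp := by
    unfold facePoint
    exact (PiLp.continuous_ofLp 2 _).sub (Continuous.matrix_mulVec continuous_const h1)
  simp only [faceRegion, Set.ofPred_and, Set.ofPred_forall]
  refine (isClosed_iInter fun r => ?_).inter (isClosed_iInter fun r => ?_)
  · exact isClosed_le continuous_const ((continuous_apply r).comp h1)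
  · exact isClosed_le ((continuous_apply r).comp (Continuous.matrix_mulVec continuous_const h2))
      continuous_const

lemma rowSub_mulVec_facePoint (hK : LinearIndependent ℝ (rowSub B K).row)
    (q : EuclideanSpace ℝ κ) :
    rowSub B K *ᵥ (facePoint B c K q).ofLp = fun r : K => c r := by
  rw [facePoint, faceMultiplier, WithLp.ofLp_toLp, Matrix.mulVec_sub, Matrix.mulVec_mulVec,
    Matrix.mulVec_mulVec, Matrix.mul_nonsing_inv _ (isUnit_det_gram hK), Matrix.one_mulVec,
    sub_sub_cancel]

/-- On the region belonging to `K` the projector onto the polyhedron is given by `facePoint`. -/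
lemma isProjection_facePoint (hK : LinearIndependent ℝ (rowSub B K).row)
    {q : EuclideanSpace ℝ κ} (hq : q ∈ faceRegion B c K) :
    IsProjection (polyhedron B c) q (facePoint B c K q) := by
  refine .of_inner_le hq.2 fun z hz => ?_
  have h1 : (q - facePoint B c K q).ofLp = (rowSub B K)ᵀ *ᵥ faceMultiplier B c K q := by
    simp [facePoint]
  rw [inner_eq_dotProduct, h1, Matrix.mulVec_transpose, ← Matrix.dotProduct_mulVec,
    WithLp.ofLp_sub, Matrix.mulVec_sub, rowSub_mulVec_facePoint hK]
  refine Finset.sum_nonpos fun r _ => mul_nonpos_of_nonneg_of_nonpos (hq.1 r) ?_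
  exact sub_nonpos.2 (hz r)

/-- If `K` is admissible for the HS-Jacobian at `q`, then `q` belongs to the region of `K`. -/
lemma mem_faceRegion_of_isMultiplier [Fintype ρ] (hK : LinearIndependent ℝ (rowSub B K).row)
    {q p : EuclideanSpace ℝ κ} {μ : ρ → ℝ} (hμ : IsMultiplier B c q p μ)
    (hsupp : ∀ r, μ r ≠ 0 → r ∈ K) (hact : ∀ r ∈ K, (B *ᵥ p.ofLp) r = c r) :
    q ∈ faceRegion B c K ∧ facePoint B c K q = p := by
  obtain ⟨hμ0, hstat, hfeas, -⟩ := hμ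
  have h1 : Bᵀ *ᵥ μ = (rowSub B K)ᵀ *ᵥ fun r : K => μ r := by
    ext k
    simp only [Matrix.mulVec, dotProduct, Matrix.transpose_apply, rowSub, Matrix.submatrix_apply,
      id]
    rw [Finset.sum_coe_sort K (fun r => B r k * μ r)]
    refine (Finset.sum_subset (Finset.subset_univ _) fun r _ hr => ?_).symm
    rw [not_imp_comm.1 (hsupp r) hr, mul_zero]
  have hp : p.ofLp = q.ofLp - (rowSub B K)ᵀ *ᵥ fun r : K => μ r := by
    rw [← h1]
    exact eq_sub_of_add_eq (sub_eq_zero.1 (by rw [← hstat]; abel))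
  have hBp : rowSub B K *ᵥ p.ofLp = fun r : K => c r := funext fun r => hact r r.2
  have hm : faceMultiplier B c K q = fun r : K => μ r := by
    have h2 : rowSub B K *ᵥ q.ofLp - (fun r : K => c r) =
        (rowSub B K * (rowSub B K)ᵀ) *ᵥ fun r : K => μ r := by
      rw [← hBp, hp, Matrix.mulVec_sub, sub_sub_cancel, Matrix.mulVec_mulVec]
    rw [faceMultiplier, h2, Matrix.mulVec_mulVec, Matrix.nonsing_inv_mul _ (isUnit_det_gram hK),
      Matrix.one_mulVec]
  have hfp : facePoint B c K q = p := by
    apply WithLp.ofLp_injective 2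
    rw [facePoint, hm, hp]
  refine ⟨⟨fun r => ?_, fun r => ?_⟩, hfp⟩
  · rw [hm]; exact hμ0 r
  · rw [hfp]; exact sub_nonpos.1 (hfeas r)

/-- The orthogonal projector `I - B_Kᵀ (B_K B_Kᵀ)⁻¹ B_K` onto the kernel of `B_K`. -/
def kerProjector [DecidableEq κ] (B : Matrix ρ κ ℝ) (K : Finset ρ) : Matrix κ κ ℝ :=
  1 - (rowSub B K)ᵀ * (rowSub B K * (rowSub B K)ᵀ)⁻¹ * rowSub B K

variable [DecidableEq κ]

/-- The displacement lies in the row space of `B_K`. This later removes the cross term in the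
second-order expansion of `φ`. -/
lemma kerProjector_mulVec_sub_facePoint (hK : LinearIndependent ℝ (rowSub B K).row)
    (q : EuclideanSpace ℝ κ) : act (kerProjector B K) (q - facePoint B c K q) = 0 := by
  have h1 : (q - facePoint B c K q).ofLp = (rowSub B K)ᵀ *ᵥ faceMultiplier B c K q := by
    simp [facePoint]
  rw [act, h1, kerProjector, Matrix.mulVec_mulVec, Matrix.sub_mul, Matrix.one_mul,
    Matrix.mul_assoc, Matrix.mul_assoc, Matrix.nonsing_inv_mul _ (isUnit_det_gram hK),
    Matrix.mul_one, sub_self, Matrix.zero_mulVec]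
  rfl

lemma facePoint_sub_facePoint (q q' : EuclideanSpace ℝ κ) :
    facePoint B c K q - facePoint B c K q' = act (kerProjector B K) (q - q') := by
  apply WithLp.ofLp_injective 2
  simp only [facePoint, faceMultiplier, act, kerProjector, WithLp.ofLp_sub, Matrix.sub_mulVec,
    Matrix.one_mulVec, Matrix.mulVec_sub, ← Matrix.mulVec_mulVec]
  abel

lemma kerProjector_transpose : (kerProjector B K)ᵀ = kerProjector B K := by
  simp [kerProjector, Matrix.transpose_sub, Matrix.transpose_mul, Matrix.transpose_nonsing_inv,
    Matrix.mul_assoc]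

lemma kerProjector_mul_self (hK : LinearIndependent ℝ (rowSub B K).row) :
    kerProjector B K * kerProjector B K = kerProjector B K := by
  have h : kerProjector B K * (rowSub B K)ᵀ = 0 := by
    rw [kerProjector, Matrix.sub_mul, Matrix.one_mul, Matrix.mul_assoc, Matrix.mul_assoc,
      Matrix.nonsing_inv_mul _ (isUnit_det_gram hK), Matrix.mul_one, sub_self]
  conv_lhs => rw [show kerProjector B K * kerProjector B K = kerProjector B K *
    (1 - (rowSub B K)ᵀ * (rowSub B K * (rowSub B K)ᵀ)⁻¹ * rowSub B K) from rfl]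
  rw [Matrix.mul_sub, Matrix.mul_one, Matrix.mul_assoc, ← Matrix.mul_assoc _ (rowSub B K)ᵀ, h,
    Matrix.zero_mul, sub_zero]

variable [Fintype ρ]

/-- `N` is a symmetric idempotent matrix. -/
def IsOrthProjector (N : Matrix κ κ ℝ) : Prop := Nᵀ = N ∧ N * N = N

lemma isOrthProjector_of_mem_hsJacobian {q : EuclideanSpace ℝ κ} {N : Matrix κ κ ℝ}
    (hN : N ∈ hsJacobian B c q) : IsOrthProjector N := by
  obtain ⟨p, μ, K, -, -, -, -, hK, rfl⟩ := hN
  exact ⟨kerProjector_transpose, kerProjector_mul_self hK⟩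

/-- Near `q'`, the elements of the HS-Jacobian of the projector onto a polyhedron from a finite
family linearize the projector exactly. -/
theorem eventually_hsJacobian_linearizes {S : Set (Matrix ρ κ ℝ)} (hS : S.Finite) (c : ρ → ℝ)
    (q' : EuclideanSpace ℝ κ) :
    ∀ᶠ q in 𝓝 q', ∀ B ∈ S, ∀ N ∈ hsJacobian B c q, ∃ p p', IsProjection (polyhedron B c) q p ∧
      IsProjection (polyhedron B c) q' p' ∧ p - p' = act N (q - q') ∧ act N (q' - p') = 0 := by
  -- There are finitely many closed regions; those missing `q'` are avoided by a neighbourhood of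
  -- it.
  have h1 : ∀ᶠ q in 𝓝 q', ∀ B ∈ S, ∀ K : Finset ρ,
      q ∈ faceRegion B c K → q' ∈ faceRegion B c K := by
    rw [hS.eventually_all]
    intro B _
    rw [eventually_all]
    intro K
    by_cases h : q' ∈ faceRegion B c K
    · exact Eventually.of_forall fun _ _ => h
    · filter_upwards [isClosed_faceRegion.isOpen_compl.mem_nhds h] with q hq hq'
      exact absurd hq' hq
  filter_upwards [h1] with q hq B hB N hN
  obtain ⟨p, μ, K, hp, hμ, hsupp, hact, hK, rfl⟩ := hN
  obtain ⟨hqK, hfp⟩ := mem_faceRegion_of_isMultiplier hK hμ hsupp hact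
  refine ⟨p, facePoint B c K q', hp, isProjection_facePoint hK (hq B hB K hqK), ?_,
    kerProjector_mulVec_sub_facePoint hK q'⟩
  rw [← hfp]
  exact facePoint_sub_facePoint q q'

end Polyhedron

end MTLasso
end

noncomputable section

namespace MTLasso

open Filter Topology Matrix

/-! ### The projector onto the `ℓ_{1,∞}`-ball and its moving polyhedral descriptions. -/

lemma sign_mul_self_eq_abs (x : ℝ) : Real.sign x * x = |x| := by
  rcases lt_trichotomy x 0 with h | h | h
  · simp [Real.sign_of_neg h, abs_of_neg h]
  · simp [h]
  · simp [Real.sign_of_pos h, abs_of_pos h]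

lemma norm1inf_eq_sum_norm {d n : ℕ} (W : Matrix (Fin d) (Fin n) ℝ) :
    norm1inf W = ∑ i, ‖(fun j => W i j : Fin n → ℝ)‖ := by
  refine Finset.sum_congr rfl fun i _ => le_antisymm ?_ ?_
  · exact Real.iSup_le (fun j => norm_le_pi_norm (fun j => W i j) j) (norm_nonneg _)
  · refine (pi_norm_le_iff_of_nonneg (Real.iSup_nonneg fun j => abs_nonneg _)).2 fun j => ?_
    exact le_ciSup (f := fun j => |W i j|) (Set.finite_range _).bddAbove j

namespace PALSubproblem

variable {d n : ℕ} {m : Fin n → ℕ} (P : PALSubproblem d n m)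

/-! ### The fixed convex set -/

/-- The `ℓ_{1,∞}`-ball in the reduced space. -/
def ball : Set P.Space := {z | norm1inf (P.extend z) ≤ P.γ}

lemma extend_add (z z' : P.Space) : P.extend (z + z') = P.extend z + P.extend z' := by
  ext i j
  by_cases h : (i, j) ∈ P.I <;> simp [extend, h]

lemma extend_smul (a : ℝ) (z : P.Space) : P.extend (a • z) = a • P.extend z := by
  ext i j
  by_cases h : (i, j) ∈ P.I <;> simp [extend, h]

lemma continuous_extend_apply (i : Fin d) (j : Fin n) : Continuous fun z => P.extend z i j := by
  by_cases h : (i, j) ∈ P.I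
  · simp only [extend, Matrix.of_apply, h, dif_pos]
    fun_prop
  · simp only [extend, Matrix.of_apply, h, dif_neg, not_false_eq_true]
    exact continuous_const

lemma extend_zero : P.extend 0 = 0 := by
  ext i j
  simp [extend]

lemma ball_nonempty : P.ball.Nonempty :=
  ⟨0, by simp [ball, extend_zero, norm1inf, P.γ_pos.le]⟩

lemma isClosed_ball : IsClosed P.ball := by
  simp only [ball, norm1inf_eq_sum_norm]
  refine isClosed_le (continuous_finsetSum _ fun i _ => ?_) continuous_const
  exact (continuous_pi fun j => P.continuous_extend_apply i j).norm

lemma convex_ball : Convex ℝ P.ball := by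
  intro z hz z' hz' a b ha hb hab
  simp only [ball, norm1inf_eq_sum_norm, Set.mem_ofPred_eq] at hz hz' ⊢
  have h1 : ∑ i, ‖(fun j => P.extend (a • z + b • z') i j : Fin n → ℝ)‖ ≤
      ∑ i, (a * ‖(fun j => P.extend z i j : Fin n → ℝ)‖ +
        b * ‖(fun j => P.extend z' i j : Fin n → ℝ)‖) := by
    refine Finset.sum_le_sum fun i _ => ?_
    have h2 : (fun j => P.extend (a • z + b • z') i j : Fin n → ℝ) =
        a • (fun j => P.extend z i j) + b • (fun j => P.extend z' i j) := by
      ext j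
      simp [extend_add, extend_smul]
    rw [h2]
    refine (norm_add_le _ _).trans (le_of_eq ?_)
    rw [norm_smul, norm_smul, Real.norm_of_nonneg ha, Real.norm_of_nonneg hb]
  rw [Finset.sum_add_distrib, ← Finset.mul_sum, ← Finset.mul_sum] at h1
  calc _ ≤ _ := h1
    _ ≤ a * P.γ + b * P.γ := add_le_add (mul_le_mul_of_nonneg_left hz ha)
        (mul_le_mul_of_nonneg_left hz' hb)
    _ = P.γ := by rw [← add_mul, hab, one_mul]

/-- The metric projector onto the `ℓ_{1,∞}`-ball. -/
def proj (q : P.Space) : P.Space :=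
  (exists_isProjection P.ball_nonempty P.isClosed_ball.isComplete P.convex_ball q).choose

lemma isProjection_proj (q : P.Space) : IsProjection P.ball q (P.proj q) :=
  (exists_isProjection P.ball_nonempty P.isClosed_ball.isComplete P.convex_ball q).choose_spec

lemma continuous_proj : Continuous P.proj := by
  refine LipschitzWith.continuous (K := 1) (LipschitzWith.of_dist_le_mul fun q r => ?_)
  rw [NNReal.coe_one, one_mul, dist_eq_norm, dist_eq_norm]
  exact (P.isProjection_proj q).norm_sub_le P.convex_ball (P.isProjection_proj r)

/-! ### The polyhedra belonging to nearby points -/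

/-- The sign pattern and the leading entries of `q` are admissible for `q'` as well. -/
structure IsCompatible (q q' : P.Space) : Prop where
  sign : ∀ i j, Real.sign (P.extend q i j) * P.extend q' i j = |P.extend q' i j|
  lead : ∀ i a, (∀ l, |P.extend q i l| ≤ |P.extend q i a|) →
    ∀ l, |P.extend q' i l| ≤ |P.extend q' i a|

lemma isCompatible_self (q : P.Space) : P.IsCompatible q q :=
  ⟨fun _ _ => sign_mul_self_eq_abs _, fun _ _ h => h⟩

/-- Nonzero entries keep their sign and strict inequalities between absolute values persist; zero
entries of `q'` satisfy the sign condition for any `q`. -/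
lemma eventually_isCompatible (q' : P.Space) : ∀ᶠ q in 𝓝 q', P.IsCompatible q q' := by
  have h1 : ∀ᶠ q in 𝓝 q', ∀ i j,
      Real.sign (P.extend q i j) * P.extend q' i j = |P.extend q' i j| := by
    refine eventually_all.2 fun i => eventually_all.2 fun j => ?_
    have hc := (P.continuous_extend_apply i j).tendsto q'
    rcases lt_trichotomy (P.extend q' i j) 0 with h | h | h
    · filter_upwards [hc.eventually (gt_mem_nhds h)] with q hq
      simp [Real.sign_of_neg hq, abs_of_neg h]
    · simp [h]
    · filter_upwards [hc.eventually (lt_mem_nhds h)] with q hq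
      simp [Real.sign_of_pos hq, abs_of_pos h]
  have h2 : ∀ᶠ q in 𝓝 q', ∀ i a l, |P.extend q i l| ≤ |P.extend q i a| →
      |P.extend q' i l| ≤ |P.extend q' i a| := by
    refine eventually_all.2 fun i => eventually_all.2 fun a => eventually_all.2 fun l => ?_
    by_cases h : |P.extend q' i l| ≤ |P.extend q' i a|
    · exact Eventually.of_forall fun _ _ => h
    · have hc := (P.continuous_extend_apply i a).abs.tendsto q'
      have hc' := (P.continuous_extend_apply i l).abs.tendsto q'
      filter_upwards [hc.eventually_lt hc' (not_le.1 h)] with q hq hq'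
      exact absurd hq' (not_le.2 hq)
  filter_upwards [h1, h2] with q hq hq'
  exact ⟨hq, fun i a h l => hq' i a l (h l)⟩

lemma norm_sub_le_of_abs_le {z z' q : P.Space} (h : ∀ k, |z' k - q k| ≤ |z k - q k|) :
    ‖z' - q‖ ≤ ‖z - q‖ := by
  rw [EuclideanSpace.norm_eq, EuclideanSpace.norm_eq]
  refine Real.sqrt_le_sqrt (Finset.sum_le_sum fun k _ => ?_)
  have := h k
  simp only [PiLp.sub_apply, Real.norm_eq_abs]
  gcongr

lemma extend_apply (z : P.Space) (k : P.I) : P.extend z k.1.1 k.1.2 = z k := by simp [extend]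

variable {P}

/-- Clipping a point of the ball gives a point of `C̄(q)` and of the ball that is not farther
from `q'`. -/
lemma IsCompatible.exists_mem_inter {q q' : P.Space} (hq : P.IsCompatible q q') {z : P.Space}
    (hz : z ∈ P.ball) : ∃ z' ∈ P.Cbar q, z' ∈ P.ball ∧ ‖z' - q'‖ ≤ ‖z - q'‖ := by
  let θ : Fin d → ℝ := fun i => ⨆ j, |P.extend z i j|
  have hθ : ∀ i j, |P.extend z i j| ≤ θ i := fun i j =>
    le_ciSup (f := fun j => |P.extend z i j|) (Set.finite_range _).bddAbove j
  have hθ0 : ∀ i, 0 ≤ θ i := fun i => Real.iSup_nonneg fun j => abs_nonneg _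
  -- Clip `q'` at the row maxima `θ` of `z`, with signs taken from `q`; where `q` vanishes,
  -- compatibility forces `q'` to vanish too.
  let z' : P.Space := WithLp.toLp 2 fun k => Real.sign (q k) * min |q' k| (θ k.1.1)
  have hz' : ∀ i j, P.extend z' i j =
      Real.sign (P.extend q i j) * min |P.extend q' i j| (θ i) := by
    intro i j
    by_cases h : (i, j) ∈ P.I <;> simp [extend, h, z']
  have hm0 : ∀ i j, 0 ≤ min |P.extend q' i j| (θ i) := fun i j => le_min (abs_nonneg _) (hθ0 i)
  have hs : ∀ i j, Real.sign (P.extend q i j) * P.extend z' i j =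
      min |P.extend q' i j| (θ i) := by
    intro i j
    rw [hz']
    rcases lt_trichotomy (P.extend q i j) 0 with h | h | h
    · simp [Real.sign_of_neg h]
    · have := hq.sign i j
      rw [h, Real.sign_zero, zero_mul] at this
      simp [h, ← this, hθ0]
    · simp [Real.sign_of_pos h]
  refine ⟨z', (P.mem_Cbar q z').2 ⟨fun i j => ?_, fun i j => ?_, ?_⟩, ?_,
    P.norm_sub_le_of_abs_le fun k => ?_⟩
  · rw [hs]; exact hm0 i j
  · obtain ⟨a, ha, hsum⟩ := leadSign_sum (P.extend q) i j
    rw [hsum (fun l => P.extend z' i l), hs, hs]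
    exact min_le_min_right _ (hq.lead i a ha j)
  · refine (Finset.sum_le_sum fun i _ => ?_).trans hz
    by_cases hn : Nonempty (Fin n)
    · obtain ⟨j⟩ := hn
      obtain ⟨a, ha, hsum⟩ := leadSign_sum (P.extend q) i j
      rw [hsum (fun l => P.extend z' i l), hs]
      exact min_le_right _ _
    · rw [not_nonempty_iff] at hn
      rw [Finset.univ_eq_empty, Finset.sum_empty]
      exact hθ0 i
  · refine le_trans (Finset.sum_le_sum fun i _ => Real.iSup_le (fun j => ?_) (hθ0 i)) hz
    rw [hz', abs_mul, abs_of_nonneg (hm0 i j)]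
    have h1 : |Real.sign (P.extend q i j)| ≤ 1 := by
      rcases Real.sign_apply_eq (P.extend q i j) with h | h | h <;> simp [h]
    calc _ ≤ 1 * min |P.extend q' i j| (θ i) := mul_le_mul_of_nonneg_right h1 (hm0 i j)
      _ ≤ θ i := by rw [one_mul]; exact min_le_right _ _
  · have h1 := hθ k.1.1 k.1.2
    rw [extend_apply] at h1
    have h3 := abs_le.1 h1
    have h5 := hq.sign k.1.1 k.1.2
    rw [extend_apply, extend_apply] at h5
    have h0 := hθ0 k.1.1
    change |Real.sign (q k) * min |q' k| (θ k.1.1) - q' k| ≤ _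
    rcases le_total |q' k| (θ k.1.1) with h4 | h4
    · rw [min_eq_left h4, ← h5, ← mul_assoc]
      rcases Real.sign_apply_eq (q k) with h | h | h
      · simp [h]
      · rw [h, zero_mul] at h5
        simp [abs_eq_zero.1 h5.symm]
      · simp [h]
    · rw [min_eq_right h4]
      rcases Real.sign_apply_eq (q k) with h | h | h
      · rw [h] at h5 ⊢
        rw [← h5] at h4
        exact abs_le_abs (by linarith) (by linarith)
      · rw [h, zero_mul] at h5
        simp [h, abs_eq_zero.1 h5.symm]
      · rw [h] at h5 ⊢
        rw [← h5] at h4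
        rw [abs_sub_comm, abs_sub_comm (z k)]
        exact abs_le_abs (by linarith) (by linarith)

/-- Deleting the unconstrained entries of a point of `C̄(q)` gives a point of the ball that is not
farther from `q'`. -/
lemma IsCompatible.exists_mem_ball {q q' : P.Space} (hq : P.IsCompatible q q') {z : P.Space}
    (hz : z ∈ P.Cbar q) : ∃ z' ∈ P.ball, ‖z' - q'‖ ≤ ‖z - q'‖ := by
  obtain ⟨h1, h2, h3⟩ := (P.mem_Cbar q z).1 hz
  -- At zeros of `q` the constraints do not bound the size of `z`; there `q' = 0` as well, so `0` is
  -- the nearest choice.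
  let z' : P.Space := WithLp.toLp 2 fun k => if q k = 0 then 0 else z k
  have hz' : ∀ i j, P.extend z' i j = if P.extend q i j = 0 then 0 else P.extend z i j := by
    intro i j
    by_cases h : (i, j) ∈ P.I <;> simp [extend, h, z']
  refine ⟨z', ?_, P.norm_sub_le_of_abs_le fun k => ?_⟩
  · refine le_trans (Finset.sum_le_sum fun i _ => ?_) h3
    by_cases hn : Nonempty (Fin n)
    · refine ciSup_le fun j => ?_
      rw [hz']
      split_ifs with h
      · rw [abs_zero]; exact (h1 i j).trans (h2 i j)
      · refine le_trans (le_of_eq ?_) (h2 i j)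
        have := h1 i j
        rcases lt_or_gt_of_ne h with h | h
        · rw [Real.sign_of_neg h] at this ⊢
          rw [abs_of_nonpos (by linarith)]; ring
        · rw [Real.sign_of_pos h] at this ⊢
          rw [abs_of_nonneg (by linarith)]; ring
    · rw [not_nonempty_iff] at hn
      rw [Real.iSup_of_isEmpty, Finset.univ_eq_empty, Finset.sum_empty]
  · change |(if q k = 0 then 0 else z k) - q' k| ≤ _
    split_ifs with h
    · have h5 := hq.sign k.1.1 k.1.2
      rw [extend_apply, extend_apply, h, Real.sign_zero, zero_mul] at h5
      simp [abs_eq_zero.1 h5.symm]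
    · exact le_rfl

/-- Points compatible with `q` have the same projections onto `C̄(q)` and the ball. -/
theorem IsCompatible.isProjection_Cbar {q q' : P.Space} (hq : P.IsCompatible q q') :
    IsProjection (P.Cbar q) q' (P.proj q') := by
  have hp := P.isProjection_proj q'
  refine ⟨?_, fun z hz => ?_⟩
  -- The clipped projection is in the ball and no farther from `q'`, so it is the projection itself.
  · obtain ⟨z', hz', hzb, hle⟩ := hq.exists_mem_inter hp.1
    rwa [← hp.unique P.convex_ball hzb hle]
  · obtain ⟨z', hz', hle⟩ := hq.exists_mem_ball hz
    exact (hp.2 z' hz').trans hle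

variable (P)

lemma convex_Cbar (q : P.Space) : Convex ℝ (P.Cbar q) := by
  intro z hz z' hz' a b ha hb hab r
  have h1 := mul_le_mul_of_nonneg_left (hz r) ha
  have h2 := mul_le_mul_of_nonneg_left (hz' r) hb
  have h3 : (P.Bbar q *ᵥ (a • z + b • z').ofLp) r =
      a * (P.Bbar q *ᵥ z.ofLp) r + b * (P.Bbar q *ᵥ z'.ofLp) r := by
    rw [WithLp.ofLp_add, WithLp.ofLp_smul, WithLp.ofLp_smul, Matrix.mulVec_add, Matrix.mulVec_smul,
      Matrix.mulVec_smul]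
    rfl
  rw [h3]
  refine (add_le_add h1 h2).trans (le_of_eq ?_)
  rw [← add_mul, hab, one_mul]

/-- Every entry is a sign or a difference of two signs. Finiteness gives one neighbourhood that
serves all the polyhedra. -/
lemma finite_range_Bbar : (Set.range P.Bbar).Finite := by
  have hT : ({-2, -1, 0, 1, 2} : Set ℝ).Finite := by simp
  refine (Set.Finite.pi fun _ : RowIdx d n => Set.Finite.pi fun _ : P.I => hT).subset ?_
  rintro _ ⟨q, rfl⟩ r - k -
  have hF : ∀ p k, matF (P.extend q) p k = -1 ∨ matF (P.extend q) p k = 0 ∨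
      matF (P.extend q) p k = 1 := by
    intro p k
    rw [matF, Matrix.diagonal_apply]
    split_ifs
    · exact Real.sign_apply_eq _
    · simp
  have hT : ∀ i j, leadSign (P.extend q) i j = -1 ∨ leadSign (P.extend q) i j = 0 ∨
      leadSign (P.extend q) i j = 1 := by
    intro i j
    rw [leadSign, Matrix.of_apply]
    split_ifs
    · exact Real.sign_apply_eq _
    · simp
  have hE : ∀ i k, matE (P.extend q) i k = -1 ∨ matE (P.extend q) i k = 0 ∨
      matE (P.extend q) i k = 1 := by
    intro i k
    rw [matE, Matrix.of_apply]
    split_ifs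
    · exact hT _ _
    · simp
  simp only [Set.mem_insert_iff, Set.mem_singleton_iff]
  rcases r with p | p | u
  · change -matF (P.extend q) p k = _ ∨ -matF (P.extend q) p k = _ ∨ -matF (P.extend q) p k = _ ∨
      -matF (P.extend q) p k = _ ∨ -matF (P.extend q) p k = _
    rcases hF p k with h | h | h <;> norm_num [h]
  · change matF (P.extend q) p k - matE (P.extend q) p.1 k = _ ∨
      matF (P.extend q) p k - matE (P.extend q) p.1 k = _ ∨
      matF (P.extend q) p k - matE (P.extend q) p.1 k = _ ∨
      matF (P.extend q) p k - matE (P.extend q) p.1 k = _ ∨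
      matF (P.extend q) p k - matE (P.extend q) p.1 k = _
    rcases hF p k with h | h | h <;> rcases hE p.1 k with h' | h' | h' <;> norm_num [h, h']
  · change leadSign (P.extend q) k.1.1 k.1.2 = _ ∨ leadSign (P.extend q) k.1.1 k.1.2 = _ ∨
      leadSign (P.extend q) k.1.1 k.1.2 = _ ∨ leadSign (P.extend q) k.1.1 k.1.2 = _ ∨
      leadSign (P.extend q) k.1.1 k.1.2 = _
    rcases hT k.1.1 k.1.2 with h | h | h <;> norm_num [h]

/-- Near `q'`, the elements of the generalized HS-Jacobian linearize the projector onto the ball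
exactly. -/
theorem eventually_proj_sub (q' : P.Space) :
    ∀ᶠ q in 𝓝 q', ∀ N ∈ hsJacobian (P.Bbar q) (vecC d n P.γ) q,
      P.proj q - P.proj q' = act N (q - q') ∧ act N (q' - P.proj q') = 0 := by
  filter_upwards [eventually_hsJacobian_linearizes P.finite_range_Bbar (vecC d n P.γ) q',
    P.eventually_isCompatible q'] with q hq hc N hN
  obtain ⟨p, p', hp, hp', h1, h2⟩ := hq _ ⟨q, rfl⟩ N hN
  have e1 : P.proj q = p := hp.unique (P.convex_Cbar q)
    (P.isCompatible_self q).isProjection_Cbar.1 ((P.isCompatible_self q).isProjection_Cbar.2 _ hp.1)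
  have e2 : P.proj q' = p' := hp'.unique (P.convex_Cbar q)
    hc.isProjection_Cbar.1 (hc.isProjection_Cbar.2 _ hp'.1)
  rw [e1, e2]
  exact ⟨h1, h2⟩

end PALSubproblem

end MTLasso
end

noncomputable section

namespace MTLasso

open Filter Topology Matrix

/-! ### Matrix actions and orthogonal projectors. -/

section Matrices

variable {κ ι : Type} [Fintype κ] [Fintype ι]

lemma inner_act_comm {M : Matrix κ κ ℝ} (hM : Mᵀ = M) (x y : EuclideanSpace ℝ κ) :
    inner ℝ (act M x) y = inner ℝ x (act M y) := by
  simp only [inner_eq_dotProduct, act]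
  rw [Matrix.dotProduct_mulVec, ← Matrix.mulVec_transpose, hM]

lemma inner_toLp_transpose_mulVec (A : Matrix ι κ ℝ) (u : EuclideanSpace ℝ ι)
    (v : EuclideanSpace ℝ κ) :
    inner ℝ (WithLp.toLp 2 (Aᵀ *ᵥ u.ofLp)) v = inner ℝ u (WithLp.toLp 2 (A *ᵥ v.ofLp)) := by
  simp only [inner_eq_dotProduct]
  rw [Matrix.mulVec_transpose, Matrix.dotProduct_mulVec]

lemma IsOrthProjector.inner_sub_act {N : Matrix κ κ ℝ} (hN : IsOrthProjector N)
    (v : EuclideanSpace ℝ κ) : inner ℝ v (v - act N v) = ‖v - act N v‖ ^ 2 := by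
  have h1 : act N (v - act N v) = 0 := by
    simp [act, Matrix.mulVec_sub, Matrix.mulVec_mulVec, hN.2]
  have h2 : inner ℝ (act N v) (v - act N v) = 0 := by
    rw [inner_act_comm hN.1, h1, inner_zero_right]
  rw [← real_inner_self_eq_norm_sq]
  conv_rhs => rw [inner_sub_left, h2, sub_zero]

lemma IsOrthProjector.norm_sub_act_le {N : Matrix κ κ ℝ} (hN : IsOrthProjector N)
    (v : EuclideanSpace ℝ κ) : ‖v - act N v‖ ≤ ‖v‖ := by
  have h1 := hN.inner_sub_act v
  have h2 := real_inner_le_norm v (v - act N v)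
  by_contra! hc
  nlinarith [norm_nonneg v]

end Matrices

/-! ### Gradient, quadratic bounds and surrogate Hessians of `φ`. -/

namespace PALSubproblem

variable {d n : ℕ} {m : Fin n → ℕ} (P : PALSubproblem d n m)

/-- The prediction `X_I w`. -/
def predict : P.Space →ₗ[ℝ] EuclideanSpace ℝ ((i : Fin n) × Fin (m i)) :=
  Matrix.toEuclideanLin P.XI

/-- The map `u ↦ X_Iᵀ u`. -/
def predictAdj : EuclideanSpace ℝ ((i : Fin n) × Fin (m i)) →ₗ[ℝ] P.Space :=
  Matrix.toEuclideanLin P.XIᵀ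

lemma inner_predictAdj (u : EuclideanSpace ℝ ((i : Fin n) × Fin (m i))) (v : P.Space) :
    inner ℝ (P.predictAdj u) v = inner ℝ u (P.predict v) :=
  inner_toLp_transpose_mulVec P.XI u v

/-- The gradient of `φ`. -/
def grad (w : P.Space) : P.Space :=
  P.predictAdj (P.predict w - P.y) + P.σ • (P.shift w - P.proj (P.shift w)) +
    P.σ⁻¹ • (w - P.wt)

/-- A bound for `X_Iᵀ X_I`. -/
def gramBound : ℝ := ‖LinearMap.toContinuousLinearMap (P.predictAdj ∘ₗ P.predict)‖

lemma norm_gram_le (v : P.Space) : ‖P.predictAdj (P.predict v)‖ ≤ P.gramBound * ‖v‖ :=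
  (LinearMap.toContinuousLinearMap (P.predictAdj ∘ₗ P.predict)).le_opNorm v

lemma norm_predict_sq_le (v : P.Space) : ‖P.predict v‖ ^ 2 ≤ P.gramBound * ‖v‖ ^ 2 := by
  rw [← real_inner_self_eq_norm_sq, ← inner_predictAdj]
  refine (real_inner_le_norm _ _).trans ?_
  nlinarith [P.norm_gram_le v, norm_nonneg v]

/-- Here the polyhedron depending on `w` disappears in favour of the fixed ball. -/
lemma φ_eq (w : P.Space) : P.φ w = (1 / 2) * ‖P.predict w - P.y‖ ^ 2 -
    1 / (2 * P.σ) * ‖P.ut‖ ^ 2 + P.σ * (1 / 2 * ‖P.shift w - P.proj (P.shift w)‖ ^ 2) +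
    P.σ⁻¹ / 2 * ‖w - P.wt‖ ^ 2 := by
  rw [φ, (P.isCompatible_self (P.shift w)).isProjection_Cbar.moreauIndicator_eq, norm_sub_rev P.y]
  have h : 1 / (2 * P.σ) = P.σ⁻¹ / 2 := by rw [one_div, mul_inv]; ring
  rw [h]
  rfl

lemma half_norm_add_sq {E : Type} [NormedAddCommGroup E] [InnerProductSpace ℝ E] (a b : E) :
    1 / 2 * ‖a + b‖ ^ 2 = 1 / 2 * ‖a‖ ^ 2 + inner ℝ a b + 1 / 2 * ‖b‖ ^ 2 := by
  rw [norm_add_sq_real]; ring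

/-- Expand `q' - proj q'` around `q - proj q`, drop the square, and use the obtuse angle inequality
at `proj q`. -/
lemma envelope_lower (q q' : P.Space) :
    1 / 2 * ‖q - P.proj q‖ ^ 2 + inner ℝ (q - P.proj q) (q' - q) ≤
      1 / 2 * ‖q' - P.proj q'‖ ^ 2 := by
  have h := (P.isProjection_proj q).inner_le P.convex_ball (P.isProjection_proj q').1
  have h1 := half_norm_add_sq (q - P.proj q) ((q' - P.proj q') - (q - P.proj q))
  rw [add_sub_cancel, show (q' - P.proj q') - (q - P.proj q) = (q' - q) - (P.proj q' - P.proj q) by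
    abel, inner_sub_right] at h1
  have h2 := sq_nonneg ‖q' - q - (P.proj q' - P.proj q)‖
  linarith

/-- `proj q` is a feasible competitor in the projection of `q'`. -/
lemma envelope_upper (q q' : P.Space) :
    1 / 2 * ‖q' - P.proj q'‖ ^ 2 ≤ 1 / 2 * ‖q - P.proj q‖ ^ 2 + inner ℝ (q - P.proj q) (q' - q) +
      1 / 2 * ‖q' - q‖ ^ 2 := by
  have h := (P.isProjection_proj q').2 _ (P.isProjection_proj q).1
  rw [norm_sub_rev, norm_sub_rev _ q'] at h
  have h1 := half_norm_add_sq (q - P.proj q) (q' - q)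
  rw [show q - P.proj q + (q' - q) = q' - P.proj q by abel] at h1
  have h2 := pow_le_pow_left₀ (norm_nonneg _) h 2
  linarith

lemma shift_sub (v w : P.Space) : P.shift v - P.shift w = v - w := by
  simp [shift]

lemma inner_grad (w e : P.Space) : inner ℝ (P.grad w) e =
    inner ℝ (P.predict w - P.y) (P.predict e) +
      P.σ * inner ℝ (P.shift w - P.proj (P.shift w)) e + P.σ⁻¹ * inner ℝ (w - P.wt) e := by
  simp only [grad, inner_add_left, inner_predictAdj, inner_smul_left, RCLike.conj_to_real]

/-- The expansion of `φ` around `w`, up to the expansion of the envelope. -/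
lemma φ_sub (w v : P.Space) : P.φ v = P.φ w + inner ℝ (P.grad w) (v - w) +
    1 / 2 * ‖P.predict (v - w)‖ ^ 2 + P.σ⁻¹ / 2 * ‖v - w‖ ^ 2 +
    P.σ * (1 / 2 * ‖P.shift v - P.proj (P.shift v)‖ ^ 2 -
      1 / 2 * ‖P.shift w - P.proj (P.shift w)‖ ^ 2 -
      inner ℝ (P.shift w - P.proj (P.shift w)) (v - w)) := by
  have h1 := half_norm_add_sq (P.predict w - P.y) (P.predict (v - w))
  rw [show P.predict w - P.y + P.predict (v - w) = P.predict v - P.y by rw [map_sub]; abel] at h1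
  have h2 := half_norm_add_sq (w - P.wt) (v - w)
  rw [show w - P.wt + (v - w) = v - P.wt by abel] at h2
  rw [φ_eq, φ_eq, inner_grad, h1]
  linear_combination P.σ⁻¹ * h2

/-- The proximal term supplies the modulus `1/σ`; the upper constant adds the curvatures of the
three terms. -/
lemma quadraticBounds :
    QuadraticBounds P.φ P.grad P.σ⁻¹ (P.gramBound + P.σ + P.σ⁻¹) where
  pos := inv_pos.2 P.σ_pos
  le := by
    have h1 : 0 ≤ P.gramBound := norm_nonneg _
    linarith [P.σ_pos]
  lower w v := by
    have h := P.envelope_lower (P.shift w) (P.shift v)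
    rw [shift_sub] at h
    rw [P.φ_sub w v]
    have h1 := mul_nonneg P.σ_pos.le (sub_nonneg.2 h)
    have h2 := sq_nonneg ‖P.predict (v - w)‖
    linarith
  upper w v := by
    have h := P.envelope_upper (P.shift w) (P.shift v)
    rw [shift_sub] at h
    rw [P.φ_sub w v]
    have h1 := mul_nonneg P.σ_pos.le (sub_nonneg.2 h)
    have h2 := P.norm_predict_sq_le (v - w)
    linarith

lemma continuous_grad : Continuous P.grad := by
  have h1 : Continuous P.shift := continuous_id.add continuous_const
  have h2 : Continuous P.predict := LinearMap.continuous_of_finiteDimensional _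
  have h3 : Continuous P.predictAdj := LinearMap.continuous_of_finiteDimensional _
  exact ((h3.comp (h2.sub continuous_const)).add
    ((h1.sub (P.continuous_proj.comp h1)).const_smul P.σ)).add
      ((continuous_id.sub continuous_const).const_smul P.σ⁻¹)

/-- The surrogate Hessians as linear maps. -/
def hessians (w : P.Space) : Set (P.Space →ₗ[ℝ] P.Space) := Matrix.toEuclideanLin '' P.𝓜 w

lemma act_hessian (N : Matrix P.I P.I ℝ) (v : P.Space) :
    act (P.XIᵀ * P.XI + P.σ • (1 - N) + P.σ⁻¹ • (1 : Matrix P.I P.I ℝ)) v =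
      P.predictAdj (P.predict v) + P.σ • (v - act N v) + P.σ⁻¹ • v := by
  apply WithLp.ofLp_injective 2
  simp [act, predict, predictAdj, Matrix.add_mulVec, Matrix.sub_mulVec, Matrix.smul_mulVec]

lemma exists_of_mem_hessians {w : P.Space} {A : P.Space →ₗ[ℝ] P.Space} (hA : A ∈ P.hessians w) :
    ∃ N ∈ hsJacobian (P.Bbar (P.shift w)) (vecC d n P.γ) (P.shift w),
      ∀ v, A v = P.predictAdj (P.predict v) + P.σ • (v - act N v) + P.σ⁻¹ • v := by
  obtain ⟨_, ⟨N, hN, rfl⟩, rfl⟩ := hA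
  exact ⟨N, hN, P.act_hessian N⟩

lemma inner_hessian (N : Matrix P.I P.I ℝ) (u v : P.Space) :
    inner ℝ u (P.predictAdj (P.predict v) + P.σ • (v - act N v) + P.σ⁻¹ • v) =
      inner ℝ (P.predict u) (P.predict v) + P.σ * inner ℝ u (v - act N v) +
        P.σ⁻¹ * inner ℝ u v := by
  rw [inner_add_right, inner_add_right, inner_smul_right, inner_smul_right,
    real_inner_comm _ u, inner_predictAdj, real_inner_comm (P.predict u)]

/-- As `N` is an orthogonal projector, `I - N` is positive semidefinite of norm at most `1`. -/
lemma isSpectralBounded {w : P.Space} {A : P.Space →ₗ[ℝ] P.Space} (hA : A ∈ P.hessians w) :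
    IsSpectralBounded P.σ⁻¹ (P.gramBound + P.σ + P.σ⁻¹) A := by
  obtain ⟨N, hN, hA⟩ := P.exists_of_mem_hessians hA
  have hp := isOrthProjector_of_mem_hsJacobian hN
  have hσ := P.σ_pos
  refine ⟨fun u v => ?_, fun v => ?_, fun v => ?_⟩
  · rw [hA, hA, real_inner_comm, inner_hessian, inner_hessian, inner_sub_right, inner_sub_right,
      ← inner_act_comm hp.1, real_inner_comm u v, real_inner_comm u (act N v),
      real_inner_comm (P.predict u)]
  · rw [hA, inner_hessian, hp.inner_sub_act, real_inner_self_eq_norm_sq,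
      real_inner_self_eq_norm_sq]
    have h1 := mul_nonneg hσ.le (sq_nonneg ‖v - act N v‖)
    have h2 := sq_nonneg ‖P.predict v‖
    linarith
  · rw [hA, add_mul, add_mul]
    refine (norm_add₃_le).trans (add_le_add (add_le_add (P.norm_gram_le v) ?_) ?_)
    · rw [norm_smul, Real.norm_of_nonneg hσ.le]
      exact mul_le_mul_of_nonneg_left (hp.norm_sub_act_le v) hσ.le
    · rw [norm_smul, Real.norm_of_nonneg (inv_nonneg.2 hσ.le)]

/-- Near `what`, the surrogate Hessians give exact expansions of `∇φ` and `φ`. -/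
lemma eventually_hessian_linearizes (what : P.Space) :
    ∀ᶠ w in 𝓝 what, ∀ A ∈ P.hessians w, P.grad w = P.grad what + A (w - what) ∧
      P.φ w = P.φ what + inner ℝ (P.grad what) (w - what) +
        1 / 2 * inner ℝ (w - what) (A (w - what)) := by
  have hc : Tendsto P.shift (𝓝 what) (𝓝 (P.shift what)) :=
    (continuous_id.add continuous_const : Continuous P.shift).tendsto what
  filter_upwards [hc.eventually (P.eventually_proj_sub (P.shift what))] with w hw A hA
  obtain ⟨N, hN, hA⟩ := P.exists_of_mem_hessians hA
  have hp := isOrthProjector_of_mem_hsJacobian hN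
  obtain ⟨h1, h2⟩ := hw N hN
  rw [shift_sub] at h1
  have h3 : P.shift w - P.proj (P.shift w) = (P.shift what - P.proj (P.shift what)) +
      ((w - what) - act N (w - what)) := by
    rw [← h1, ← P.shift_sub w what]; abel
  constructor
  · rw [hA, grad, grad, h3, map_sub P.predict w, map_sub P.predictAdj, map_sub P.predictAdj,
      map_sub P.predictAdj]
    module
  -- The envelope is exactly quadratic here because `N` is symmetric and annihilates `P.shift what -
  -- P.proj (P.shift what)`.
  · rw [P.φ_sub what w, hA, inner_hessian, h3, half_norm_add_sq, inner_sub_right _ (w - what)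
      (act N (w - what)), ← inner_act_comm hp.1 (P.shift what - P.proj (P.shift what)), h2,
      inner_zero_left, hp.inner_sub_act, real_inner_self_eq_norm_sq, real_inner_self_eq_norm_sq]
    ring

end PALSubproblem

end MTLasso
end

open MTLasso Filter Topology Asymptotics in
theorem mainTheorem3 {d n : ℕ} {m : Fin n → ℕ} (P : PALSubproblem d n m)
    (ϱ ν τ ϖ : ℝ) (hϱ : 0 < ϱ ∧ ϱ < 1 / 2) (hν : 0 < ν ∧ ν < 1) (hτ : 0 < τ ∧ τ ≤ 1)
    (hϖ : 0 < ϖ ∧ ϖ < 1)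
    (w : ℕ → P.Space) (hw : IsSsnSequence P ϱ ν τ ϖ w) :
    ContDiff ℝ 1 P.φ ∧ StrongConvexOn Set.univ P.σ⁻¹ P.φ ∧
    ∃ what : P.Space,
      (∀ v, P.φ what ≤ P.φ v) ∧
      (∀ v, (∀ v', P.φ v ≤ P.φ v') → v = what) ∧
      Tendsto w atTop (𝓝 what) ∧
      (fun j => ‖w (j + 1) - what‖) =O[atTop] (fun j => ‖w j - what‖ ^ (1 + τ)) ∧
      (fun j => ‖w (j + 1) - what‖) =o[atTop] (fun j => ‖w j - what‖) ∧
      (τ = 1 → (fun j => ‖w (j + 1) - what‖) =O[atTop] (fun j => ‖w j - what‖ ^ 2)) := by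
  have H := P.quadraticBounds
  refine ⟨H.contDiff_one P.continuous_grad, H.strongConvexOn,
    H.newton_convergence (Ms := P.hessians) (fun _ _ hA => P.isSpectralBounded hA)
      P.eventually_hessian_linearizes hϱ hν.2 hτ.1 hϖ fun j => ?_⟩
  obtain ⟨M, hM, h, hcg, hres, hstep⟩ := hw j
  -- The algorithm refers to `gradient P.φ`, the abstract Newton step to the explicit `P.grad`.
  rw [H.gradient_eq] at hcg hres hstep
  exact ⟨_, ⟨M, hM, rfl⟩, h, hcg, hres, hstep⟩
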